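/- Let $G$ be a group with identity $e$ and let $\|\cdot\|:G\to[0,\infty)$ be a norm: $\|g\|=0$ iff $g=e$, $\|gh\|\le\|g\|+\|h\|$ and $\|g^{-1}\|=\|g\|$ for all $g,h\in G$. Assume that $V(\rho)=\#\{g\in G:\|g\|\le\rho\}$ is finite for every $\rho$ and that, for some constant $C_{VD}$, $V(2\rho)\le C_{VD}V(\rho)$ for all $\rho>0$. Let $\nu$ be a symmetric probability measure on $G$, with convolution powers $\nu^{(n)}$, and set $$p_t(g)=e^{-t}\sum_{n\ge0}\frac{t^n}{n!}\nu^{(n)}(g),\qquad p(t,x,y)=p_t(x^{-1}y),\qquad \delta_R=\sum_{\|x\|>R}\nu(x),\qquad \mathcal G(R)=\sum_{\|x\|\le R}\|x\|^2\nu(x).$$ Let $(X_s)_{s\ge0}$ be the continuous time random walk driven by $\nu$ and started at $e$, i.e. the right-continuous process with $X_0=e$ whose finite dimensional distributions are given by the transition densities $p(t,x,y)$; write $\mathbf P_e$ for its law. Let $m:[0,\infty)\to[0,\infty)$ be continuous and regularly varying at infinity with negative index, and assume $p_t(e)\le m(t)$ for all $t>0$. For functions $f,g$ on $(0,\infty)$,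 $f\simeq g$ means that $cg\le f\le Cg$ on $(0,\infty)$ for some constants $c,C\in(0,\infty)$. Given $\varepsilon>0$, call a pair $(R,r)$ of functions $(0,\infty)\to(0,\infty)$ $\varepsilon$-admissible if, for all $t>0$, $$2t\,\delta_{R(t)}<\varepsilon,\qquad \frac{t\,\mathcal G(R(t))}{R(t)^2}<e^{-1},\qquad r(t)\ge R(t),$$ $r$ is continuous and non-decreasing, and $\sup_{t>0}\{m(t)V(r(t))e^{-r(t)/6R(t)}\}<\infty$. **(1)** Let $\varepsilon>0$ and let $(R,r)$ be $\varepsilon$-admissible. Then there is $\gamma_0\ge1$ such that, for all $\gamma\ge\gamma_0$ and all $t>0$, $$\mathbf P_e\Big(\sup_{s\le t}\|X_s\|\ge\gamma r(t)\Big)<\varepsilon\qquad\text{and}\qquad p(t,e,e)\ge\frac{1-\varepsilon}{V(\gamma r(t))}.$$ If moreover $\varepsilon<1$ and $V(r(t))^{-1}\simeq m(t)$, then $p_t(e)\simeq V(r(t))^{-1}$. **(2)** Let $r:(0,\infty)\to(0,\infty)$ satisfy $V(r(t))^{-1}\simeq m(t)$, and suppose that for every $\varepsilon>0$ there are a constant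 $A\ge1$ and a function $R$ such that $(R,Ar)$ is $\varepsilon$-admissible. Then $\nu$ is $(\|\cdot\|,r)$-controlled in continuous time: $p_t(e)\simeq V(r(t))^{-1}$, and for every $\varepsilon>0$ there is $\gamma\in(0,\infty)$ such that $\mathbf P_e(\sup_{s\le t}\|X_s\|\ge\gamma r(t))\le\varepsilon$ for all $t>0$. -/

import Mathlib

open MeasureTheory Filter Set
open scoped ENNReal Topology

universe u v

noncomputable section

namespace RandomWalkControl

variable {G : Type u} [Group G]

/-- The volume function `V(ρ) = #{g : ‖g‖ ≤ ρ}` of a norm on a group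
(meaningful when the balls are finite). -/
def ballVolume (N : GroupNorm G) (ρ : ℝ) : ℝ :=
  (Set.ncard {g : G | N g ≤ ρ} : ℝ)

/-- The `n`-th convolution power `ν^{(n)}`, i.e. the law of `ξ₁ ⋯ ξₙ` with `ξᵢ` i.i.d. of law `ν`. -/
def convPow (ν : PMF G) : ℕ → PMF G
  | 0 => PMF.pure 1
  | n + 1 => (convPow ν n).bind fun x => ν.map fun y => x * y

/-- `p_t(g) = e^{-t} ∑ₙ tⁿ / n! ν^{(n)}(g)`; the transition density is `p(t,x,y) = p_t(x⁻¹y)`. -/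
def heatKernel (ν : PMF G) (t : ℝ) (g : G) : ℝ :=
  Real.exp (-t) * ∑' n : ℕ, t ^ n / (n.factorial : ℝ) * (convPow ν n g).toReal

/-- `δ_R = ∑_{‖x‖ > R} ν(x)`. -/
def tailMass (N : GroupNorm G) (ν : PMF G) (R : ℝ) : ℝ :=
  ∑' x : G, Set.indicator {x : G | R < N x} (fun x => (ν x).toReal) x

/-- `𝒢(R) = ∑_{‖x‖ ≤ R} ‖x‖² ν(x)`. -/
def truncatedSecondMoment (N : GroupNorm G) (ν : PMF G) (R : ℝ) : ℝ :=
  ∑' x : G, Set.indicator {x : G | N x ≤ R} (fun x => N x ^ 2 * (ν x).toReal) x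

/-- `m` is regularly varying at infinity with index `a`. -/
def IsRegularlyVarying (m : ℝ → ℝ) (a : ℝ) : Prop :=
  (∀ᶠ t in atTop, 0 < m t) ∧
    ∀ l : ℝ, 0 < l → Tendsto (fun t => m (l * t) / m t) atTop (𝓝 (l ^ a))

/-- `f ≃ g` on `(0, ∞)`: the ratio is bounded between two positive constants. -/
def Comparable (f g : ℝ → ℝ) : Prop :=
  ∃ c C : ℝ, 0 < c ∧ 0 < C ∧ ∀ t : ℝ, 0 < t → c * g t ≤ f t ∧ f t ≤ C * g t

/-- `X` is a realization of the continuous time random walk driven by `ν` and started at the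
identity: almost surely right-continuous paths (for the discrete topology on `G`), and
finite dimensional distributions given by the transition densities `p(t,x,y) = p_t(x⁻¹y)`. -/
structure IsContinuousTimeWalk (ν : PMF G) {Ω : Type v} [MeasurableSpace Ω]
    (P : Measure Ω) (X : ℝ → Ω → G) : Prop where
  measurableSet_eq : ∀ t : ℝ, 0 ≤ t → ∀ g : G, MeasurableSet {ω | X t ω = g}
  right_continuous : ∀ᵐ ω ∂P, ∀ t : ℝ, 0 ≤ t → ∀ᶠ s in 𝓝[>] t, X s ω = X t ω
  fdd : ∀ (n : ℕ) (t : ℕ → ℝ) (x : ℕ → G), t 0 = 0 → Monotone t → x 0 = 1 →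
    P {ω | ∀ i ≤ n, X (t i) ω = x i} =
      ENNReal.ofReal (∏ i ∈ Finset.range n,
        heatKernel ν (t (i + 1) - t i) ((x i)⁻¹ * x (i + 1)))

/-- `sup_{0 ≤ s ≤ t} ‖X_s‖`, as an extended nonnegative number. -/
def runningSup (N : GroupNorm G) {Ω : Type v} (X : ℝ → Ω → G) (t : ℝ) (ω : Ω) : ℝ≥0∞ :=
  ⨆ s ∈ Set.Icc (0 : ℝ) t, ENNReal.ofReal (N (X s ω))

/-- The conditions, for a given `ε`, on the truncation function `R` and the scaling function `r`. -/
structure Admissible (N : GroupNorm G) (ν : PMF G) (m : ℝ → ℝ) (ε : ℝ) (R r : ℝ → ℝ) : Prop where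
  R_pos : ∀ t : ℝ, 0 < t → 0 < R t
  tail_lt : ∀ t : ℝ, 0 < t → 2 * t * tailMass N ν (R t) < ε
  moment_lt : ∀ t : ℝ, 0 < t → t * truncatedSecondMoment N ν (R t) / R t ^ 2 < Real.exp (-1)
  R_le : ∀ t : ℝ, 0 < t → R t ≤ r t
  continuousOn : ContinuousOn r (Set.Ioi 0)
  monotoneOn : MonotoneOn r (Set.Ioi 0)
  bounded : ∃ K : ℝ, ∀ t : ℝ, 0 < t →
    m t * ballVolume N (r t) * Real.exp (-(r t / (6 * R t))) ≤ K

/-- `ν` is `(‖·‖, r)`-controlled in continuous time: `p_t(e) ≃ 1 / V(r(t))`, and for every `ε > 0`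
there is `γ > 0` with `P_e(sup_{s ≤ t} ‖X_s‖ ≥ γ r(t)) ≤ ε` for all `t > 0`. -/
def IsControlled (N : GroupNorm G) (ν : PMF G) (r : ℝ → ℝ) : Prop :=
  Comparable (fun t => heatKernel ν t 1) (fun t => (ballVolume N (r t))⁻¹) ∧
    ∀ ε : ℝ, 0 < ε → ∃ γ : ℝ, 0 < γ ∧ ∀ t : ℝ, 0 < t →
      ∀ (Ω : Type v) [MeasurableSpace Ω] (P : Measure Ω) [IsProbabilityMeasure P]
        (X : ℝ → Ω → G), IsContinuousTimeWalk ν P X →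
          P {ω | ENNReal.ofReal (γ * r t) ≤ runningSup N X t ω} ≤ ENNReal.ofReal ε

end RandomWalkControl

end

/-! Fix `t` and erase the jumps larger than `R = R(t)`. Expanding the Poisson series shows that the
truncated kernel is at most `e^{t δ_R}` times the original one (`heatLaw_truncLaw_le`), and `t δ_R <
ε/2`. Thus the truncated walk inherits the on-diagonal upper bound, and the original walk inherits
lower bounds from the truncated one at the cost of a factor `e^{-t δ_R}`.

For the truncated walk, sampled with mesh `t/n`, Nash's entropy method bounds the mean norm by a
multiple of `r(t)`. If `s² ≈ R²/n` bounds the second moment of a step, the mean norm `M` and the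
entropy `H` satisfy `M_{k+2} - M_k ≤ α (H_{k+1} - H_k) + s²/α` (`meanNorm_sub_le`). The on-diagonal
bound, polynomial in `n/k`, bounds `H_k` from below, so summation with `α = s√k` gives `M_j ≤ s√n
(H_n + log A + const)` (`le_of_entropy_increments`). Conversely `H_n` is at most the logarithm of
the volume at scale `M_n` (`entropy_le`), which under doubling exceeds `log V(r)` by a multiple of
`1 + log⁺(M_n/r)`. Admissibility bounds `log A + log V(r)` by `r/(6R) + const`, and the prefactor
`s√n ≲ R` turns this into `O(r)`. Hence `M_n/r` is bounded by an affine function of its own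
logarithm, uniformly in `n` and `t`.

Markov's and Ottaviani's inequalities then confine the truncated walk at all mesh times. Comparing
path probabilities carries this to `X`, and dyadic refinement with right-continuity reaches the
running supremum. Finally `p_t(e) = ∑ p_{t/2}(x)²` and Cauchy–Schwarz on a ball holding most of the
mass give the lower bound; doubling absorbs `γ`. -/

noncomputable section

namespace RandomWalkControl

variable {G : Type u} [Group G]

/-! ### Convolution of laws on a group -/

/-- The law of the product of two independent random elements of laws `p` and `q`. -/
def mulLaw (p q : PMF G) : PMF G := p.bind fun x => q.map fun y => x * y

lemma map_mul_left_apply (q : PMF G) (x z : G) : (q.map fun y => x * y) z = q (x⁻¹ * z) := by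
  rw [PMF.map_apply, tsum_eq_single (x⁻¹ * z)]
  · simp
  · intro b hb
    rw [if_neg]
    rintro rfl
    simp at hb

lemma mulLaw_apply (p q : PMF G) (z : G) : mulLaw p q z = ∑' x, p x * q (x⁻¹ * z) := by
  simp only [mulLaw, PMF.bind_apply, map_mul_left_apply]

lemma convPow_succ (ν : PMF G) (n : ℕ) : convPow ν (n + 1) = mulLaw (convPow ν n) ν := rfl

lemma mulLaw_assoc (p q r : PMF G) : mulLaw (mulLaw p q) r = mulLaw p (mulLaw q r) := by
  simp only [mulLaw, PMF.bind_bind, PMF.map_bind, PMF.bind_map, PMF.map_comp]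
  congr 1; funext x; congr 1; funext y
  simp [Function.comp_def, mul_assoc]

lemma mulLaw_pure_one (p : PMF G) : mulLaw p (PMF.pure 1) = p := by
  simp [mulLaw, PMF.pure_map]

lemma pure_one_mulLaw (p : PMF G) : mulLaw (PMF.pure 1) p = p := by
  simp only [mulLaw, PMF.pure_bind, one_mul]
  exact PMF.map_id p

lemma convPow_add (ν : PMF G) (a b : ℕ) :
    convPow ν (a + b) = mulLaw (convPow ν a) (convPow ν b) := by
  induction b with
  | zero => exact (mulLaw_pure_one _).symm
  | succ b ih => rw [← add_assoc, convPow_succ, ih, mulLaw_assoc, ← convPow_succ]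

lemma tsum_mul_left_eq (f : G → ℝ≥0∞) (x : G) : ∑' y, f (x * y) = ∑' y, f y :=
  (Equiv.mulLeft x).tsum_eq f

lemma tsum_inv_eq (f : G → ℝ≥0∞) : ∑' y, f y⁻¹ = ∑' y, f y :=
  (Equiv.inv G).tsum_eq f

lemma tsum_mulLaw_mul (p q : PMF G) (f : G → ℝ≥0∞) :
    ∑' z, mulLaw p q z * f z = ∑' x, p x * ∑' z, q (x⁻¹ * z) * f z := by
  simp only [mulLaw_apply, ← ENNReal.tsum_mul_right, ← ENNReal.tsum_mul_left]
  rw [ENNReal.tsum_comm]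
  simp only [mul_assoc]

lemma tsum_mulLaw_mul' (p q : PMF G) (f : G → ℝ≥0∞) :
    ∑' z, mulLaw p q z * f z = ∑' x, p x * ∑' y, q y * f (x * y) := by
  rw [tsum_mulLaw_mul]
  congr 1; funext x
  rw [← tsum_mul_left_eq _ x]
  simp

lemma mulLaw_inv {p q : PMF G} (hp : ∀ g, p g⁻¹ = p g) (hq : ∀ g, q g⁻¹ = q g) (z : G) :
    mulLaw p q z⁻¹ = mulLaw q p z := by
  rw [mulLaw_apply, mulLaw_apply, ← tsum_mul_left_eq _ z⁻¹]
  congr 1; funext x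
  rw [mul_comm, ← hp (z⁻¹ * x), ← hq]
  simp

lemma convPow_inv {ν : PMF G} (hν : ∀ g, ν g⁻¹ = ν g) (n : ℕ) (g : G) :
    convPow ν n g⁻¹ = convPow ν n g := by
  induction n generalizing g with
  | zero => by_cases h : g = 1 <;> simp [convPow, PMF.pure_apply, h]
  | succ n ih =>
    have h1 : convPow ν 1 = ν := pure_one_mulLaw ν
    rw [convPow_succ, mulLaw_inv ih hν, ← convPow_succ, add_comm, convPow_add, h1]

/-! ### Poissonization and the semigroup property -/

/-- The Poisson law of parameter `r`. -/
def poissonLaw (r : NNReal) : PMF ℕ :=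
  ⟨fun n => ENNReal.ofReal (Real.exp (-r) * (r : ℝ) ^ n / n.factorial), by
    have h := ProbabilityTheory.hasSum_one_poissonMeasure r
    have hnn : ∀ n : ℕ, 0 ≤ Real.exp (-r) * (r : ℝ) ^ n / n.factorial := fun n => by positivity
    rw [← ENNReal.ofReal_one, ← h.tsum_eq, ENNReal.ofReal_tsum_of_nonneg hnn h.summable]
    exact ENNReal.summable.hasSum⟩

/-- The law of the continuous time random walk at time `t`. -/
def heatLaw (ν : PMF G) (t : ℝ) : PMF G :=
  (poissonLaw t.toNNReal).bind (convPow ν)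

lemma poissonLaw_apply {t : ℝ} (ht : 0 ≤ t) (n : ℕ) :
    poissonLaw t.toNNReal n
      = ENNReal.ofReal (Real.exp (-t) * t ^ n / n.factorial) := by
  change ENNReal.ofReal (Real.exp (-(t.toNNReal : ℝ)) * (t.toNNReal : ℝ) ^ n / n.factorial) = _
  rw [Real.coe_toNNReal t ht]

lemma heatLaw_apply (ν : PMF G) {t : ℝ} (ht : 0 ≤ t) (g : G) :
    heatLaw ν t g
      = ∑' n : ℕ, ENNReal.ofReal (Real.exp (-t) * t ^ n / n.factorial) * convPow ν n g := by
  simp only [heatLaw, PMF.bind_apply, poissonLaw_apply ht]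

lemma heatKernel_eq_toReal (ν : PMF G) {t : ℝ} (ht : 0 ≤ t) (g : G) :
    heatKernel ν t g = (heatLaw ν t g).toReal := by
  rw [heatLaw_apply ν ht, ENNReal.tsum_toReal_eq]
  · rw [heatKernel, ← tsum_mul_left]
    congr 1; funext n
    rw [ENNReal.toReal_mul, ENNReal.toReal_ofReal (by positivity)]
    ring
  · intro n
    exact ENNReal.mul_ne_top ENNReal.ofReal_ne_top (PMF.apply_ne_top _ _)

lemma ofReal_heatKernel (ν : PMF G) {t : ℝ} (ht : 0 ≤ t) (g : G) :
    ENNReal.ofReal (heatKernel ν t g) = heatLaw ν t g := by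
  rw [heatKernel_eq_toReal ν ht, ENNReal.ofReal_toReal (PMF.apply_ne_top _ _)]

lemma poissonLaw_add {s t : ℝ} (hs : 0 ≤ s) (ht : 0 ≤ t) :
    poissonLaw (s + t).toNNReal =
      (poissonLaw s.toNNReal).bind fun a =>
        (poissonLaw t.toNNReal).map fun b => a + b := by
  ext n
  have hinner : ∀ a, ((poissonLaw t.toNNReal).map fun b => a + b) n =
      if a ≤ n then poissonLaw t.toNNReal (n - a) else 0 := by
    intro a
    rw [PMF.map_apply]
    split_ifs with h
    · rw [tsum_eq_single (n - a)]
      · rw [if_pos (by omega)]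
      · intro b hb
        rw [if_neg (by omega)]
    · rw [ENNReal.tsum_eq_zero]
      intro b
      rw [if_neg (by omega)]
  simp only [PMF.bind_apply, hinner]
  rw [tsum_eq_sum (s := Finset.range (n + 1))]
  · rw [poissonLaw_apply (add_nonneg hs ht), add_pow, Finset.mul_sum, Finset.sum_div,
      ENNReal.ofReal_sum_of_nonneg (fun i _ => by positivity)]
    refine Finset.sum_congr rfl fun a ha => ?_
    have han : a ≤ n := by simpa [Nat.lt_succ_iff] using ha
    rw [if_pos han, poissonLaw_apply hs, poissonLaw_apply ht,
      ← ENNReal.ofReal_mul (by positivity)]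
    congr 1
    rw [neg_add, Real.exp_add, Nat.cast_choose ℝ han]
    have := Nat.factorial_pos n
    field_simp
  · intro a ha
    rw [if_neg (by simpa using ha), mul_zero]

lemma heatLaw_add (ν : PMF G) {s t : ℝ} (hs : 0 ≤ s) (ht : 0 ≤ t) :
    heatLaw ν (s + t) = mulLaw (heatLaw ν s) (heatLaw ν t) := by
  simp only [heatLaw, poissonLaw_add hs ht, mulLaw, PMF.bind_bind, PMF.bind_map, PMF.map_bind]
  congr 1; funext a
  simp only [Function.comp_def, convPow_add]
  rw [PMF.bind_comm]
  rfl

lemma heatLaw_zero (ν : PMF G) : heatLaw ν 0 = PMF.pure 1 := by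
  ext g
  rw [heatLaw_apply ν le_rfl, tsum_eq_single 0]
  · simp [convPow]
  · intro n hn
    simp [hn]

lemma convPow_heatLaw (ν : PMF G) {h : ℝ} (hh : 0 ≤ h) (k : ℕ) :
    convPow (heatLaw ν h) k = heatLaw ν (k * h) := by
  induction k with
  | zero => simp [convPow, heatLaw_zero]
  | succ k ih =>
    rw [convPow_succ, ih, ← heatLaw_add ν (by positivity) hh]
    congr 1
    push_cast
    ring

lemma heatLaw_inv {ν : PMF G} (hν : ∀ g, ν g⁻¹ = ν g) (t : ℝ) (g : G) :
    heatLaw ν t g⁻¹ = heatLaw ν t g := by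
  simp only [heatLaw, PMF.bind_apply, convPow_inv hν]

/-! ### On-diagonal domination and monotonicity -/

lemma mulLaw_le_sup {p q : PMF G} {c : ℝ≥0∞} (hp : ∀ g, p g ≤ c) (hq : ∀ g, q g⁻¹ = q g) (z : G) :
    mulLaw p q z ≤ c := by
  rw [mulLaw_apply]
  calc ∑' x, p x * q (x⁻¹ * z) ≤ ∑' x, c * q (z⁻¹ * x) := by
        refine ENNReal.tsum_le_tsum fun x => ?_
        rw [← hq (z⁻¹ * x)]
        simp only [mul_inv_rev, inv_inv]
        gcongr
        exact hp x
    _ = c := by rw [ENNReal.tsum_mul_left, tsum_mul_left_eq, q.tsum_coe, mul_one]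

lemma mulLaw_self_one {p : PMF G} (hp : ∀ g, p g⁻¹ = p g) : mulLaw p p 1 = ∑' x, p x ^ 2 := by
  rw [mulLaw_apply]
  simp [hp, sq]

/-- At the half time, `p_t(g) = ∑ p(x) p(g⁻¹x)` by symmetry. Apply `2ab ≤ a² + b²` termwise: by
translation invariance both sums of squares equal `p_t(e)`. -/
lemma heatLaw_le_one_apply {ν : PMF G} (hν : ∀ g, ν g⁻¹ = ν g) {t : ℝ} (ht : 0 ≤ t) (g : G) :
    heatLaw ν t g ≤ heatLaw ν t 1 := by
  have h2 : heatLaw ν t = mulLaw (heatLaw ν (t / 2)) (heatLaw ν (t / 2)) := by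
    rw [← heatLaw_add ν (by positivity) (by positivity), add_halves]
  set p := heatLaw ν (t / 2) with hpdef
  have hp : ∀ g, p g⁻¹ = p g := heatLaw_inv hν _
  have key : 2 * mulLaw p p g ≤ 2 * mulLaw p p 1 := by
    rw [mulLaw_self_one hp, two_mul (∑' x, p x ^ 2)]
    nth_rewrite 2 [← tsum_mul_left_eq _ g⁻¹]
    rw [← ENNReal.tsum_add, mulLaw_apply, ← ENNReal.tsum_mul_left]
    refine ENNReal.tsum_le_tsum fun x => ?_
    rw [← hp (x⁻¹ * g)]
    simp only [mul_inv_rev, inv_inv]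
    have hab := PMF.apply_ne_top p x
    have hbb := PMF.apply_ne_top p (g⁻¹ * x)
    lift p x to NNReal using hab with a
    lift p (g⁻¹ * x) to NNReal using hbb with b
    norm_cast
    have := two_mul_le_add_sq (a : ℝ) b
    rw [← mul_assoc]
    exact_mod_cast this
  rw [h2]
  exact (ENNReal.mul_le_mul_iff_right (by norm_num) (by norm_num)).1 key

lemma heatLaw_one_anti {ν : PMF G} (hν : ∀ g, ν g⁻¹ = ν g) {s t : ℝ} (hs : 0 ≤ s) (hst : s ≤ t) :
    heatLaw ν t 1 ≤ heatLaw ν s 1 := by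
  have : t = s + (t - s) := by ring
  rw [this, heatLaw_add ν hs (by linarith)]
  exact mulLaw_le_sup (fun g => heatLaw_le_one_apply hν hs g) (heatLaw_inv hν _) 1

lemma exp_neg_le_heatKernel (ν : PMF G) {t : ℝ} (ht : 0 ≤ t) :
    Real.exp (-t) ≤ heatKernel ν t 1 := by
  rw [heatKernel_eq_toReal ν ht]
  rw [← ENNReal.ofReal_le_iff_le_toReal (PMF.apply_ne_top _ _), heatLaw_apply ν ht]
  refine le_trans ?_ (ENNReal.le_tsum 0)
  simp [convPow]

lemma heatKernel_pos (ν : PMF G) {t : ℝ} (ht : 0 ≤ t) : 0 < heatKernel ν t 1 :=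
  (Real.exp_pos _).trans_le (exp_neg_le_heatKernel ν ht)

/-! ### Truncation of jumps and second moments -/

/-- The law obtained from `ν` by replacing the jumps of norm larger than `R` by the identity. -/
def truncLaw (N : GroupNorm G) (ν : PMF G) (R : ℝ) : PMF G :=
  open scoped Classical in ν.map fun x => if N x ≤ R then x else 1

lemma truncLaw_inv (N : GroupNorm G) {ν : PMF G} (hν : ∀ g, ν g⁻¹ = ν g) (R : ℝ) (g : G) :
    truncLaw N ν R g⁻¹ = truncLaw N ν R g := by
  classical
  rw [truncLaw, PMF.map_apply, PMF.map_apply, ← tsum_inv_eq]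
  congr 1; funext x
  rw [map_inv_eq_map, hν]
  by_cases hx : N x ≤ R <;> simp [hx]

lemma ofReal_tailMass (N : GroupNorm G) (ν : PMF G) (R : ℝ) :
    ENNReal.ofReal (tailMass N ν R) = ∑' x, Set.indicator {x | R < N x} ν x := by
  rw [tailMass]
  have h : ∀ x, Set.indicator {x : G | R < N x} (fun x => (ν x).toReal) x
      = (Set.indicator {x : G | R < N x} ν x).toReal := by
    intro x
    by_cases hx : R < N x <;> simp [Set.indicator, hx]
  have hle : ∑' x, Set.indicator {x | R < N x} ν x ≤ 1 := by
    rw [← ν.tsum_coe]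
    exact ENNReal.tsum_le_tsum fun x => Set.indicator_le_self _ _ _
  simp only [h]
  rw [← ENNReal.tsum_toReal_eq, ENNReal.ofReal_toReal (ne_top_of_le_ne_top ENNReal.one_ne_top hle)]
  exact fun x => ne_top_of_le_ne_top (PMF.apply_ne_top ν x) (Set.indicator_le_self _ _ _)

lemma tailMass_nonneg (N : GroupNorm G) (ν : PMF G) (R : ℝ) : 0 ≤ tailMass N ν R :=
  tsum_nonneg fun _ => Set.indicator_nonneg (fun _ _ => ENNReal.toReal_nonneg) _

lemma truncLaw_le (N : GroupNorm G) (ν : PMF G) (R : ℝ) (g : G) :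
    truncLaw N ν R g ≤ ν g + ENNReal.ofReal (tailMass N ν R) * PMF.pure 1 g := by
  classical
  rw [truncLaw, PMF.map_apply, ofReal_tailMass, ← ENNReal.tsum_mul_right]
  have : ν g = ∑' a, if a = g then ν a else 0 := by simp
  rw [this, ← ENNReal.tsum_add]
  refine ENNReal.tsum_le_tsum fun a => ?_
  by_cases ha : N a ≤ R
  · simp only [ha, if_true]
    refine le_trans ?_ le_self_add
    by_cases h : g = a <;> simp [h]
  · have ha' : R < N a := not_le.1 ha
    simp only [ha, if_false]
    refine le_trans ?_ le_add_self
    by_cases h : g = 1 <;> simp [h, Set.indicator, ha', PMF.pure_apply]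

/-- The second moment of the norm. -/
def sqMoment (N : GroupNorm G) (p : PMF G) : ℝ≥0∞ := ∑' x, p x * ENNReal.ofReal (N x ^ 2)

lemma tsum_map_mul {α β : Type*} (p : PMF α) (φ : α → β) (f : β → ℝ≥0∞) :
    ∑' y, p.map φ y * f y = ∑' x, p x * f (φ x) := by
  classical
  simp only [PMF.map_apply, ← ENNReal.tsum_mul_right]
  rw [ENNReal.tsum_comm]
  congr 1; funext x
  rw [tsum_eq_single (φ x)]
  · simp
  · intro y hy
    simp [hy]

lemma sqMoment_truncLaw (N : GroupNorm G) (hball : ∀ ρ : ℝ, {g : G | N g ≤ ρ}.Finite)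
    (ν : PMF G) (R : ℝ) :
    sqMoment N (truncLaw N ν R) = ENNReal.ofReal (truncatedSecondMoment N ν R) := by
  classical
  rw [sqMoment, truncLaw, tsum_map_mul, truncatedSecondMoment, ENNReal.ofReal_tsum_of_nonneg]
  · congr 1; funext x
    by_cases hx : N x ≤ R
    · simp only [hx, if_true, Set.indicator, Set.mem_ofPred_eq]
      rw [mul_comm, ENNReal.ofReal_mul (by positivity), ENNReal.ofReal_toReal (PMF.apply_ne_top _ _)]
    · simp [hx, Set.indicator]
  · exact fun x => Set.indicator_nonneg (fun x _ => by positivity) _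
  · refine summable_of_hasFiniteSupport ((hball R).subset ?_)
    intro x hx
    by_contra h
    exact hx (Set.indicator_of_notMem h _)

/-- The gap is the perfect square `(N x - n N y)² / n`. The weight `n` is free so that the induction
in `sqMoment_convPow_le` closes exactly: `(1 + 1/n) n² + (1 + n) = (n + 1)²`. -/
lemma norm_mul_sq_le (N : GroupNorm G) (x y : G) {n : ℝ} (hn : 0 < n) :
    N (x * y) ^ 2 ≤ (1 + 1 / n) * N x ^ 2 + (1 + n) * N y ^ 2 := by
  have h1 : N (x * y) ^ 2 ≤ (N x + N y) ^ 2 :=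
    pow_le_pow_left₀ (apply_nonneg N _) (map_mul_le_add N x y) 2
  have h2 : (1 + 1 / n) * N x ^ 2 + (1 + n) * N y ^ 2 - (N x + N y) ^ 2
      = (N x - n * N y) ^ 2 / n := by
    field_simp
    ring
  have h3 : 0 ≤ (N x - n * N y) ^ 2 / n := by positivity
  linarith

lemma sqMoment_mulLaw_le (N : GroupNorm G) (p q : PMF G) {n : ℝ} (hn : 0 < n) :
    sqMoment N (mulLaw p q)
      ≤ ENNReal.ofReal (1 + 1 / n) * sqMoment N p + ENNReal.ofReal (1 + n) * sqMoment N q := by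
  rw [sqMoment, tsum_mulLaw_mul']
  calc ∑' x, p x * ∑' y, q y * ENNReal.ofReal (N (x * y) ^ 2)
      ≤ ∑' x, p x * ∑' y, q y * (ENNReal.ofReal (1 + 1 / n) * ENNReal.ofReal (N x ^ 2)
          + ENNReal.ofReal (1 + n) * ENNReal.ofReal (N y ^ 2)) := by
        gcongr with x y
        rw [← ENNReal.ofReal_mul (by positivity), ← ENNReal.ofReal_mul (by positivity),
          ← ENNReal.ofReal_add (by positivity) (by positivity)]
        exact ENNReal.ofReal_le_ofReal (norm_mul_sq_le N x y hn)
    _ = _ := by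
        simp only [mul_add, ENNReal.tsum_add, ENNReal.tsum_mul_right, q.tsum_coe, one_mul]
        rw [p.tsum_coe, one_mul, sqMoment, sqMoment, ← ENNReal.tsum_mul_left,
          ← ENNReal.tsum_mul_left]
        congr 2 <;> funext x <;> ring

lemma convPow_one (ν : PMF G) : convPow ν 1 = ν := pure_one_mulLaw ν

lemma sqMoment_pure_one (N : GroupNorm G) : sqMoment N (PMF.pure 1) = 0 := by
  rw [sqMoment, ENNReal.tsum_eq_zero]
  intro x
  by_cases h : x = 1 <;> simp [h, PMF.pure_apply]

lemma sqMoment_convPow_le (N : GroupNorm G) (ν : PMF G) (n : ℕ) :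
    sqMoment N (convPow ν n) ≤ ENNReal.ofReal ((n : ℝ) ^ 2) * sqMoment N ν := by
  induction n with
  | zero => simp [convPow, sqMoment_pure_one]
  | succ n ih =>
    rcases Nat.eq_zero_or_pos n with rfl | hn
    · simp [convPow_one]
    · have hn' : (0 : ℝ) < n := by exact_mod_cast hn
      rw [convPow_succ]
      refine (sqMoment_mulLaw_le N _ _ hn').trans ?_
      calc _ ≤ ENNReal.ofReal (1 + 1 / n) * (ENNReal.ofReal ((n : ℝ) ^ 2) * sqMoment N ν)
            + ENNReal.ofReal (1 + n) * sqMoment N ν := by gcongr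
        _ = _ := by
          rw [← mul_assoc, ← add_mul, ← ENNReal.ofReal_mul (by positivity),
            ← ENNReal.ofReal_add (by positivity) (by positivity)]
          congr 2
          push_cast
          field_simp
          ring

/-- The bound must be linear in `h`, since `h` will be a vanishing mesh. Terms with `n ≥ 1` carry `h
^ n ≤ h`, and the quadratic growth in `n` is absorbed by `n² ≤ 4 ^ n`, which sums to `e⁴`. -/
lemma sqMoment_heatLaw_le (N : GroupNorm G) (ν : PMF G) {h : ℝ} (h0 : 0 ≤ h) (h1 : h ≤ 1) :
    sqMoment N (heatLaw ν h) ≤ ENNReal.ofReal (h * Real.exp 4) * sqMoment N ν := by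
  have key : ∀ n : ℕ, Real.exp (-h) * h ^ n / n.factorial * (n : ℝ) ^ 2
      ≤ h * ((4 : ℝ) ^ n / n.factorial) := by
    intro n
    rcases Nat.eq_zero_or_pos n with rfl | hn
    · simp [h0]
    · have e1 : Real.exp (-h) ≤ 1 := Real.exp_le_one_iff.2 (by linarith)
      have e2 : h ^ n ≤ h := pow_le_of_le_one h0 h1 hn.ne'
      have e3 : (n : ℝ) ^ 2 ≤ 4 ^ n := by
        have : (n : ℝ) ≤ 2 ^ n := by exact_mod_cast Nat.lt_two_pow_self.le
        calc (n : ℝ) ^ 2 ≤ (2 ^ n) ^ 2 := by gcongr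
          _ = 4 ^ n := by rw [← pow_mul, mul_comm, pow_mul]; norm_num
      have e4 : Real.exp (-h) * h ^ n ≤ h := by
        calc Real.exp (-h) * h ^ n ≤ 1 * h := by gcongr
          _ = h := one_mul h
      calc Real.exp (-h) * h ^ n / n.factorial * (n : ℝ) ^ 2
          ≤ h / n.factorial * 4 ^ n := by gcongr
        _ = _ := by ring
  have hs : HasSum (fun n : ℕ => (4 : ℝ) ^ n / n.factorial) (Real.exp 4) := by
    rw [Real.exp_eq_exp_ℝ]
    exact NormedSpace.expSeries_div_hasSum_exp (4 : ℝ)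
  have hs' := hs.mul_left h
  calc sqMoment N (heatLaw ν h)
      = ∑' n : ℕ, ENNReal.ofReal (Real.exp (-h) * h ^ n / n.factorial)
          * sqMoment N (convPow ν n) := by
        simp only [sqMoment, heatLaw_apply ν h0, ← ENNReal.tsum_mul_right, ← ENNReal.tsum_mul_left]
        rw [ENNReal.tsum_comm]
        simp only [mul_assoc]
    _ ≤ ∑' n : ℕ, ENNReal.ofReal (h * ((4 : ℝ) ^ n / n.factorial)) * sqMoment N ν := by
        refine ENNReal.tsum_le_tsum fun n => ?_
        refine (mul_le_mul_right (sqMoment_convPow_le N ν n) _).trans ?_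
        rw [← mul_assoc, ← ENNReal.ofReal_mul (by positivity)]
        exact mul_le_mul_left (ENNReal.ofReal_le_ofReal (key n)) _
    _ = _ := by
        rw [ENNReal.tsum_mul_right, ← hs'.tsum_eq,
          ENNReal.ofReal_tsum_of_nonneg (fun n => by positivity) hs'.summable]

/-! ### Comparison of the truncated and original semigroups -/

/-- Binomial expansion of the `n`-th power of `ν + δ · PMF.pure 1`, which dominates the truncated
law; the identity mass is neutral for convolution. -/
lemma convPow_truncLaw_le (N : GroupNorm G) (ν : PMF G) (R : ℝ) (n : ℕ) (g : G) :
    convPow (truncLaw N ν R) n g ≤ ∑ ij ∈ Finset.HasAntidiagonal.antidiagonal n,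
      (n.choose ij.1 : ℝ≥0∞) * (ENNReal.ofReal (tailMass N ν R) ^ ij.2 * convPow ν ij.1 g) := by
  induction n generalizing g with
  | zero => simp [convPow]
  | succ n ih =>
    set δ := ENNReal.ofReal (tailMass N ν R)
    rw [Finset.sum_antidiagonal_choose_succ_mul (fun i j => δ ^ j * convPow ν i g) n]
    rw [convPow_succ, mulLaw_apply]
    calc ∑' x, convPow (truncLaw N ν R) n x * truncLaw N ν R (x⁻¹ * g)
        ≤ ∑' x, (∑ ij ∈ Finset.HasAntidiagonal.antidiagonal n, (n.choose ij.1 : ℝ≥0∞) *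
            (δ ^ ij.2 * convPow ν ij.1 x)) * (ν (x⁻¹ * g) + δ * PMF.pure 1 (x⁻¹ * g)) := by
          gcongr with x
          · exact ih x
          · exact truncLaw_le N ν R _
      _ = ∑ ij ∈ Finset.HasAntidiagonal.antidiagonal n, (n.choose ij.1 : ℝ≥0∞) * (δ ^ ij.2 *
            (mulLaw (convPow ν ij.1) ν g + δ * mulLaw (convPow ν ij.1) (PMF.pure 1) g)) := by
          simp only [Finset.sum_mul]
          rw [Summable.tsum_finsetSum (fun _ _ => ENNReal.summable)]
          refine Finset.sum_congr rfl fun ij _ => ?_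
          rw [mulLaw_apply, mulLaw_apply, ← ENNReal.tsum_mul_left, ← ENNReal.tsum_add,
            ← ENNReal.tsum_mul_left, ← ENNReal.tsum_mul_left]
          congr 1; funext x
          ring
      _ = _ := by
          rw [← Finset.sum_add_distrib]
          refine Finset.sum_congr rfl fun ij hij => ?_
          have : n.choose ij.2 = n.choose ij.1 := by
            rw [← Finset.HasAntidiagonal.mem_antidiagonal.1 hij]
            exact (Nat.choose_symm_add).symm
          rw [mulLaw_pure_one, ← convPow_succ, this]
          ring

lemma tsum_antidiagonal_eq (f : ℕ → ℕ → ℝ≥0∞) :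
    ∑' n, ∑ ij ∈ Finset.HasAntidiagonal.antidiagonal n, f ij.1 ij.2 = ∑' i, ∑' j, f i j := by
  rw [← ENNReal.tsum_prod, ← Finset.HasAntidiagonal.sigmaAntidiagonalEquivProd.tsum_eq, ENNReal.tsum_sigma']
  congr 1; funext n
  rw [← Finset.tsum_subtype]
  rfl

/-- With Poisson weights the binomial sums become a Cauchy product, and the erased jumps contribute
the independent factor `∑ (t δ)^j / j! = e^{t δ}`. -/
lemma heatLaw_truncLaw_le (N : GroupNorm G) (ν : PMF G) (R : ℝ) {t : ℝ} (ht : 0 ≤ t) (g : G) :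
    heatLaw (truncLaw N ν R) t g
      ≤ ENNReal.ofReal (Real.exp (t * tailMass N ν R)) * heatLaw ν t g := by
  have hδ := tailMass_nonneg N ν R
  rw [heatLaw_apply _ ht, heatLaw_apply _ ht]
  set d := tailMass N ν R with hd
  have hs : HasSum (fun n : ℕ => (t * d) ^ n / n.factorial) (Real.exp (t * d)) := by
    rw [Real.exp_eq_exp_ℝ]
    exact NormedSpace.expSeries_div_hasSum_exp (t * d)
  calc _ ≤ ∑' n : ℕ, ENNReal.ofReal (Real.exp (-t) * t ^ n / n.factorial) *
        ∑ ij ∈ Finset.HasAntidiagonal.antidiagonal n,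
          (n.choose ij.1 : ℝ≥0∞) * (ENNReal.ofReal d ^ ij.2 * convPow ν ij.1 g) := by
        gcongr with n
        exact convPow_truncLaw_le N ν R n g
    _ = ∑' n : ℕ, ∑ ij ∈ Finset.HasAntidiagonal.antidiagonal n,
          ENNReal.ofReal (Real.exp (-t) * t ^ ij.1 / ij.1.factorial) * convPow ν ij.1 g *
            ENNReal.ofReal ((t * d) ^ ij.2 / ij.2.factorial) := by
        congr 1; funext n
        rw [Finset.mul_sum]
        refine Finset.sum_congr rfl fun ij hij => ?_
        obtain ⟨i, j⟩ := ij
        obtain rfl := Finset.HasAntidiagonal.mem_antidiagonal.1 hij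
        simp only
        rw [← ENNReal.ofReal_pow hδ, ← ENNReal.ofReal_natCast, mul_right_comm _ (convPow ν i g),
          ← ENNReal.ofReal_mul (by positivity), ← mul_assoc, ← mul_assoc,
          ← ENNReal.ofReal_mul (by positivity), ← ENNReal.ofReal_mul (by positivity)]
        congr 2
        rw [Nat.cast_choose ℝ (Nat.le_add_right i j), Nat.add_sub_cancel_left]
        have := Nat.factorial_pos (i + j)
        field_simp
        ring
    _ = _ := by
        rw [tsum_antidiagonal_eq (fun i j =>
          ENNReal.ofReal (Real.exp (-t) * t ^ i / i.factorial) * convPow ν i g *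
            ENNReal.ofReal ((t * d) ^ j / j.factorial))]
        simp only [ENNReal.tsum_mul_left]
        rw [ENNReal.tsum_mul_right, mul_comm, ← hs.tsum_eq,
          ENNReal.ofReal_tsum_of_nonneg (fun n => by positivity) hs.summable]

/-! ### Entropy increments control increments of the mean norm -/

/-- The entropy gap dominates `(√u - √w)²`. Factor `u - w = (√u - √w)(√u + √w)`, use Young's
inequality with weight `α`, then `(√u + √w)² ≤ 2(u + w)`. Since `Real.log 0 = 0`, the case `w = 0 <
u` has to be excluded by `huw`. -/
lemma sub_mul_le_entropy {u w n α : ℝ} (hu : 0 ≤ u) (hw : 0 ≤ w) (huw : w = 0 → u = 0)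
    (hα : 0 < α) :
    (u - w) * n ≤ α * (u * Real.log u - u * Real.log w - u + w) + (u + w) * n ^ 2 / (2 * α) := by
  have key : (√u - √w) ^ 2 ≤ u * Real.log u - u * Real.log w - u + w := by
    rcases hw.eq_or_lt with rfl | hw
    · simp [huw rfl]
    rcases hu.eq_or_lt with rfl | hu
    · simp [Real.sq_sqrt hw.le]
    have hsu : 0 < √u := Real.sqrt_pos.2 hu
    have hsw : 0 < √w := Real.sqrt_pos.2 hw
    have h1 : Real.log (√w / √u) ≤ √w / √u - 1 := Real.log_le_sub_one_of_pos (by positivity)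
    rw [Real.log_div hsw.ne' hsu.ne', Real.log_sqrt hw.le, Real.log_sqrt hu.le] at h1
    have h2 := mul_le_mul_of_nonneg_left h1 hu.le
    have h3 : u * (√w / √u - 1) = √u * √w - u := by
      nth_rewrite 1 [← Real.sq_sqrt hu.le]
      nth_rewrite 4 [← Real.sq_sqrt hu.le]
      field_simp
    rw [h3] at h2
    have h4 := Real.sq_sqrt hu.le
    have h5 := Real.sq_sqrt hw.le
    nlinarith
  have h4 := Real.sq_sqrt hu
  have h5 := Real.sq_sqrt hw
  set s := √u
  set v := √w
  have h6 : (u - w) * n ≤ α * (s - v) ^ 2 + (s + v) ^ 2 * n ^ 2 / (4 * α) := by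
    have : α * (s - v) ^ 2 + (s + v) ^ 2 * n ^ 2 / (4 * α) - (u - w) * n
        = (2 * α * (s - v) - (s + v) * n) ^ 2 / (4 * α) := by
      rw [← h4, ← h5]
      field_simp
      ring
    have h7 : 0 ≤ (2 * α * (s - v) - (s + v) * n) ^ 2 / (4 * α) := by positivity
    linarith
  have h8 : (s + v) ^ 2 * n ^ 2 / (4 * α) ≤ (u + w) * n ^ 2 / (2 * α) := by
    have : (u + w) * n ^ 2 / (2 * α) - (s + v) ^ 2 * n ^ 2 / (4 * α)
        = (s - v) ^ 2 * n ^ 2 / (4 * α) := by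
      rw [← h4, ← h5]
      field_simp
      ring
    have h9 : 0 ≤ (s - v) ^ 2 * n ^ 2 / (4 * α) := by positivity
    linarith
  have h10 := mul_le_mul_of_nonneg_left key hα.le
  linarith

lemma entropy_gap_nonneg {u w : ℝ} (hu : 0 ≤ u) (hw : 0 ≤ w) (huw : w = 0 → u = 0) :
    0 ≤ u * Real.log u - u * Real.log w - u + w := by
  have := sub_mul_le_entropy (n := 0) hu hw huw one_pos
  simpa using this

/-- Fubini for a nonnegative kernel `K` with marginal `k`, tested against a function `f` of
arbitrary sign; it evaluates all the double sums over pairs of positions below. -/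
lemma hasSum_mul_fst {α β : Type*} {K : α × β → ℝ} (hK : ∀ z, 0 ≤ K z) {k : α → ℝ}
    (hk : ∀ x, HasSum (fun y => K (x, y)) (k x)) {f : α → ℝ} (hf : Summable fun x => k x * f x) :
    HasSum (fun z : α × β => K z * f z.1) (∑' x, k x * f x) := by
  have hs : Summable fun z : α × β => K z * f z.1 := by
    refine Summable.of_norm ?_
    rw [summable_prod_of_nonneg (fun z => norm_nonneg _)]
    have h1 : ∀ x, HasSum (fun y => ‖K (x, y) * f x‖) (k x * |f x|) := by
      intro x
      have := (hk x).mul_right |f x|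
      refine this.congr_fun fun y => ?_
      rw [Real.norm_eq_abs, abs_mul, abs_of_nonneg (hK _)]
    refine ⟨fun x => (h1 x).summable, ?_⟩
    have h2 : ∀ x, ∑' y, ‖K (x, y) * f x‖ = |k x * f x| := by
      intro x
      rw [(h1 x).tsum_eq, abs_mul, abs_of_nonneg (a := k x)]
      exact (hk x).nonneg fun y => hK _
    simp only [h2]
    exact hf.abs
  have h := hs.hasSum
  rw [hs.tsum_prod' (fun x => ((hk x).mul_right (f x)).summable)] at h
  simpa only [tsum_mul_right, (hk _).tsum_eq] using h

lemma hasSum_mul_snd {α β : Type*} {K : α × β → ℝ} (hK : ∀ z, 0 ≤ K z) {k : β → ℝ}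
    (hk : ∀ y, HasSum (fun x => K (x, y)) (k y)) {f : β → ℝ} (hf : Summable fun y => k y * f y) :
    HasSum (fun z : α × β => K z * f z.2) (∑' y, k y * f y) := by
  have := hasSum_mul_fst (K := fun z : β × α => K z.swap) (fun z => hK _) hk hf
  exact (Equiv.prodComm α β).hasSum_iff.2 this

/-- The mean of the norm. -/
def meanNorm (N : GroupNorm G) (p : PMF G) : ℝ := ∑' x, (p x).toReal * N x

/-- The Shannon entropy. -/
def entropy {α : Type*} (p : PMF α) : ℝ := ∑' x, Real.negMulLog (p x).toReal

lemma hasSum_toReal {α : Type*} (p : PMF α) : HasSum (fun x => (p x).toReal) 1 := by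
  have h := ENNReal.hasSum_toReal (f := fun x => p x) (by simp [p.tsum_coe])
  simpa [← ENNReal.tsum_toReal_eq (fun x => p.apply_ne_top x), p.tsum_coe] using h

lemma hasSum_mulLaw_toReal (p q : PMF G) (z : G) :
    HasSum (fun x => (p x).toReal * (q (x⁻¹ * z)).toReal) (mulLaw p q z).toReal := by
  have hne : ∑' x, p x * q (x⁻¹ * z) ≠ ⊤ := by
    rw [← mulLaw_apply]
    exact PMF.apply_ne_top _ _
  have h := ENNReal.hasSum_toReal hne
  rw [← ENNReal.tsum_toReal_eq (fun x => ENNReal.mul_ne_top (p.apply_ne_top _) (q.apply_ne_top _)),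
    ← mulLaw_apply] at h
  simpa using h

section EntropyStep

variable {N : GroupNorm G} {q μ : PMF G}

/-- The kernel `q(x) μ(x⁻¹y)` has marginals `q` and `mulLaw q μ`, so the logarithmic terms give the
two entropies. The two linear terms each have total mass one and cancel; they are there to make
every summand nonnegative. -/
lemma hasSum_entropy_gap (hμ : ∀ g, μ g⁻¹ = μ g)
    (hH : Summable fun x => Real.negMulLog (q x).toReal)
    (hH' : Summable fun x => Real.negMulLog (mulLaw q μ x).toReal) :
    HasSum (fun z : G × G => (μ (z.1⁻¹ * z.2)).toReal *
      ((q z.1).toReal * Real.log (q z.1).toReal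
        - (q z.1).toReal * Real.log (mulLaw q μ z.2).toReal
        - (q z.1).toReal + (mulLaw q μ z.2).toReal)) (entropy (mulLaw q μ) - entropy q) := by
  have ha1 : ∀ x, HasSum (fun y => (q x).toReal * (μ (x⁻¹ * y)).toReal) (q x).toReal := by
    intro x
    have := ((Equiv.mulLeft x⁻¹).hasSum_iff.2 (hasSum_toReal μ)).mul_left (q x).toReal
    simpa [Function.comp_def] using this
  have ha2 := hasSum_mulLaw_toReal q μ
  have hb2 : ∀ y, HasSum (fun x => (mulLaw q μ y).toReal * (μ (x⁻¹ * y)).toReal)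
      (mulLaw q μ y).toReal := by
    intro y
    have := ((Equiv.mulLeft y⁻¹).hasSum_iff.2 (hasSum_toReal μ)).mul_left (mulLaw q μ y).toReal
    simp only [Function.comp_def, Equiv.coe_mulLeft, mul_one] at this
    refine this.congr_fun fun x => ?_
    rw [← hμ (x⁻¹ * y)]
    simp
  have hneg : ∀ p : PMF G, Summable (fun x => Real.negMulLog (p x).toReal) →
      Summable fun x => (p x).toReal * Real.log (p x).toReal := by
    intro p hp
    refine hp.neg.congr fun x => ?_
    simp [Real.negMulLog]
  have s1 := hasSum_mul_fst (K := fun z : G × G => (q z.1).toReal * (μ (z.1⁻¹ * z.2)).toReal)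
    (fun z => by positivity) ha1 (f := fun x => Real.log (q x).toReal) (hneg _ hH)
  have s2 := hasSum_mul_snd (K := fun z : G × G => (q z.1).toReal * (μ (z.1⁻¹ * z.2)).toReal)
    (fun z => by positivity) ha2 (f := fun x => Real.log (mulLaw q μ x).toReal) (hneg _ hH')
  have s3 := hasSum_mul_fst (K := fun z : G × G => (q z.1).toReal * (μ (z.1⁻¹ * z.2)).toReal)
    (fun z => by positivity) ha1 (f := fun _ => 1) (by simpa using (hasSum_toReal q).summable)
  have s4 := hasSum_mul_snd
    (K := fun z : G × G => (mulLaw q μ z.2).toReal * (μ (z.1⁻¹ * z.2)).toReal)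
    (fun z => by positivity) hb2 (f := fun _ => 1)
    (by simpa using (hasSum_toReal (mulLaw q μ)).summable)
  simp only [mul_one, (hasSum_toReal _).tsum_eq] at s3 s4
  have := ((s1.sub s2).sub s3).add s4
  have hval : ∑' x, (q x).toReal * Real.log (q x).toReal
      - ∑' x, (mulLaw q μ x).toReal * Real.log (mulLaw q μ x).toReal - 1 + 1
      = entropy (mulLaw q μ) - entropy q := by
    simp only [entropy, Real.negMulLog, neg_mul, tsum_neg]
    ring
  rw [hval] at this
  refine this.congr_fun fun z => ?_
  ring

lemma mulLaw_toReal_eq_zero (x y : G) (hμ : μ (x⁻¹ * y) ≠ 0)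
    (h : (mulLaw q μ y).toReal = 0) : (q x).toReal = 0 := by
  have h1 := (ENNReal.toReal_eq_zero_iff _).1 h
  have h2 : mulLaw q μ y = 0 := h1.resolve_right (PMF.apply_ne_top _ _)
  rw [mulLaw_apply, ENNReal.tsum_eq_zero] at h2
  have h3 := (mul_eq_zero.1 (h2 x)).resolve_right hμ
  simp [h3]

lemma entropy_le_entropy_mulLaw (hμ : ∀ g, μ g⁻¹ = μ g)
    (hH : Summable fun x => Real.negMulLog (q x).toReal)
    (hH' : Summable fun x => Real.negMulLog (mulLaw q μ x).toReal) :
    entropy q ≤ entropy (mulLaw q μ) := by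
  refine sub_nonneg.1 ((hasSum_entropy_gap hμ hH hH').nonneg fun z => ?_)
  by_cases hz : μ (z.1⁻¹ * z.2) = 0
  · simp [hz]
  · exact mul_nonneg ENNReal.toReal_nonneg (entropy_gap_nonneg ENNReal.toReal_nonneg
      ENNReal.toReal_nonneg (mulLaw_toReal_eq_zero _ _ hz))

/-- Two steps are taken together because, with `q' = q * μ`, symmetry of `μ` gives `M(q' * μ) - M(q)
= ∑ μ(x⁻¹y) (q(x) - q'(y)) (N y - N x)`. The same difference of densities governs the entropy gap,
and `|N y - N x| ≤ N (x⁻¹y)` brings in the second moment of `μ`. -/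
lemma meanNorm_sub_le (hμ : ∀ g, μ g⁻¹ = μ g)
    (hH : Summable fun x => Real.negMulLog (q x).toReal)
    (hH' : Summable fun x => Real.negMulLog (mulLaw q μ x).toReal)
    (hM : Summable fun x => (q x).toReal * N x)
    (hM' : Summable fun x => (mulLaw q μ x).toReal * N x)
    (hM'' : Summable fun x => (mulLaw (mulLaw q μ) μ x).toReal * N x)
    {s : ℝ} (hs : HasSum (fun x => (μ x).toReal * N x ^ 2) s) {α : ℝ} (hα : 0 < α) :
    meanNorm N (mulLaw (mulLaw q μ) μ) - meanNorm N q
      ≤ α * (entropy (mulLaw q μ) - entropy q) + s / α := by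
  have hsymm : ∀ x y : G, μ (x⁻¹ * y) = μ (y⁻¹ * x) := by
    intro x y
    rw [← hμ (x⁻¹ * y)]
    simp
  have hNsymm : ∀ x y : G, N (x⁻¹ * y) = N (y⁻¹ * x) := by
    intro x y
    rw [← map_inv_eq_map N (x⁻¹ * y)]
    simp
  have shift : ∀ (f : G → ℝ) (c : ℝ), HasSum f c → ∀ x, HasSum (fun y => f (x⁻¹ * y)) c :=
    fun f c hf x => (Equiv.mulLeft x⁻¹).hasSum_iff.2 hf
  set q' := mulLaw q μ with hq'
  set q'' := mulLaw q' μ with hq''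
  have ha1 : ∀ x, HasSum (fun y => (q x).toReal * (μ (x⁻¹ * y)).toReal) (q x).toReal := by
    intro x
    simpa using (shift _ _ (hasSum_toReal μ) x).mul_left (q x).toReal
  have hb2 : ∀ y, HasSum (fun x => (q' y).toReal * (μ (x⁻¹ * y)).toReal) (q' y).toReal := by
    intro y
    have := (shift _ _ (hasSum_toReal μ) y).mul_left (q' y).toReal
    simpa [hsymm _ y] using this
  have hb1 : ∀ x, HasSum (fun y => (q' y).toReal * (μ (x⁻¹ * y)).toReal) (q'' x).toReal := by
    intro x
    simpa [hsymm x _] using hasSum_mulLaw_toReal q' μ x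
  have s1 := hasSum_mul_fst (K := fun z : G × G => (q z.1).toReal * (μ (z.1⁻¹ * z.2)).toReal)
    (fun z => by positivity) ha1 hM
  have s2 := hasSum_mul_snd (K := fun z : G × G => (q z.1).toReal * (μ (z.1⁻¹ * z.2)).toReal)
    (fun z => by positivity) (hasSum_mulLaw_toReal q μ) hM'
  have s3 := hasSum_mul_fst (K := fun z : G × G => (q' z.2).toReal * (μ (z.1⁻¹ * z.2)).toReal)
    (fun z => by positivity) hb1 hM''
  have s4 := hasSum_mul_snd (K := fun z : G × G => (q' z.2).toReal * (μ (z.1⁻¹ * z.2)).toReal)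
    (fun z => by positivity) hb2 hM'
  have s5 := hasSum_mul_fst (K := fun z : G × G => (q z.1).toReal *
      ((μ (z.1⁻¹ * z.2)).toReal * N (z.1⁻¹ * z.2) ^ 2))
    (fun z => by positivity) (fun x => (shift _ _ hs x).mul_left (q x).toReal) (f := fun _ => 1)
    (by simpa using ((hasSum_toReal q).mul_right s).summable)
  have s6 := hasSum_mul_snd (K := fun z : G × G => (q' z.2).toReal *
      ((μ (z.1⁻¹ * z.2)).toReal * N (z.1⁻¹ * z.2) ^ 2))
    (fun z => by positivity) (k := fun y => (q' y).toReal * s)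
    (fun y => by
      have := (shift _ _ hs y).mul_left (q' y).toReal
      simpa [hsymm _ y, hNsymm _ y] using this) (f := fun _ => 1)
    (by simpa using ((hasSum_toReal q').mul_right s).summable)
  simp only [mul_one, tsum_mul_right, (hasSum_toReal _).tsum_eq, one_mul] at s5 s6
  have hL := (s2.sub s1).add (s3.sub s4)
  have hR := ((hasSum_entropy_gap hμ hH hH').mul_left α).add ((s5.add s6).mul_right (1 / (2 * α)))
  have := hasSum_le (fun z => ?_) hL hR
  · simp only [← hq'] at this
    have e : (s + s) * (1 / (2 * α)) = s / α := by field_simp; ring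
    rw [e] at this
    simp only [meanNorm]
    linarith
  · by_cases hz : μ (z.1⁻¹ * z.2) = 0
    · simp [hz]
    have hpt := sub_mul_le_entropy (n := N z.2 - N z.1) (α := α)
      (ENNReal.toReal_nonneg (a := q z.1)) (ENNReal.toReal_nonneg (a := q' z.2))
      (mulLaw_toReal_eq_zero z.1 z.2 hz) hα
    have hn : (N z.2 - N z.1) ^ 2 ≤ N (z.1⁻¹ * z.2) ^ 2 := by
      have h1 : N z.2 ≤ N z.1 + N (z.1⁻¹ * z.2) := by
        simpa using map_mul_le_add N z.1 (z.1⁻¹ * z.2)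
      have h2 : N z.1 ≤ N z.2 + N (z.1⁻¹ * z.2) := by
        rw [hNsymm]
        simpa using map_mul_le_add N z.2 (z.2⁻¹ * z.1)
      have h3 := apply_nonneg N (z.1⁻¹ * z.2)
      refine sq_le_sq' ?_ ?_ <;> linarith
    have hpt' : ((q z.1).toReal - (q' z.2).toReal) * (N z.2 - N z.1) ≤
        α * ((q z.1).toReal * Real.log (q z.1).toReal
          - (q z.1).toReal * Real.log (q' z.2).toReal - (q z.1).toReal + (q' z.2).toReal)
        + ((q z.1).toReal + (q' z.2).toReal) * N (z.1⁻¹ * z.2) ^ 2 / (2 * α) := by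
      refine hpt.trans ?_
      gcongr
    have := mul_le_mul_of_nonneg_left hpt' (ENNReal.toReal_nonneg (a := μ (z.1⁻¹ * z.2)))
    calc _ = (μ (z.1⁻¹ * z.2)).toReal
          * (((q z.1).toReal - (q' z.2).toReal) * (N z.2 - N z.1)) := by ring
      _ ≤ _ := this
      _ = _ := by field_simp; ring

end EntropyStep

/-! ### Volume doubling and exponential sums -/

section Volume

variable {N : GroupNorm G}

lemma ballVolume_mono (hball : ∀ ρ : ℝ, {g : G | N g ≤ ρ}.Finite) {ρ σ : ℝ} (h : ρ ≤ σ) :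
    ballVolume N ρ ≤ ballVolume N σ := by
  unfold ballVolume
  exact_mod_cast Set.ncard_le_ncard (fun g hg => le_trans hg h) (hball σ)

lemma one_le_ballVolume (hball : ∀ ρ : ℝ, {g : G | N g ≤ ρ}.Finite) {ρ : ℝ} (h : 0 ≤ ρ) :
    1 ≤ ballVolume N ρ := by
  unfold ballVolume
  have : 0 < {g : G | N g ≤ ρ}.ncard :=
    (Set.ncard_pos (hball ρ)).2 ⟨1, show N 1 ≤ ρ by simpa using h⟩
  exact_mod_cast this

lemma one_le_doubling_const (hball : ∀ ρ : ℝ, {g : G | N g ≤ ρ}.Finite) {C : ℝ}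
    (hVD : ∀ ρ : ℝ, 0 < ρ → ballVolume N (2 * ρ) ≤ C * ballVolume N ρ) : 1 ≤ C := by
  have h1 := hVD 1 one_pos
  have h2 := ballVolume_mono hball (show (1 : ℝ) ≤ 2 * 1 by norm_num)
  have h3 := one_le_ballVolume hball zero_le_one
  by_contra h
  nlinarith

lemma ballVolume_two_pow_le (hball : ∀ ρ : ℝ, {g : G | N g ≤ ρ}.Finite) {C : ℝ}
    (hVD : ∀ ρ : ℝ, 0 < ρ → ballVolume N (2 * ρ) ≤ C * ballVolume N ρ) {ρ : ℝ} (hρ : 0 < ρ)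
    (k : ℕ) : ballVolume N (2 ^ k * ρ) ≤ C ^ k * ballVolume N ρ := by
  have hC := one_le_doubling_const hball hVD
  induction k with
  | zero => simp
  | succ k ih =>
    calc ballVolume N (2 ^ (k + 1) * ρ) = ballVolume N (2 * (2 ^ k * ρ)) := by ring_nf
      _ ≤ C * ballVolume N (2 ^ k * ρ) := hVD _ (by positivity)
      _ ≤ C * (C ^ k * ballVolume N ρ) := by gcongr
      _ = _ := by ring

lemma log_ballVolume_mul_le (hball : ∀ ρ : ℝ, {g : G | N g ≤ ρ}.Finite) {C : ℝ}
    (hVD : ∀ ρ : ℝ, 0 < ρ → ballVolume N (2 * ρ) ≤ C * ballVolume N ρ) {ρ y : ℝ} (hρ : 0 < ρ)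
    (hy : 1 ≤ y) : Real.log (ballVolume N (y * ρ))
      ≤ Real.log (ballVolume N ρ) + Real.log C * (1 + Real.log y / Real.log 2) := by
  have hC := one_le_doubling_const hball hVD
  set k := ⌈Real.logb 2 y⌉₊
  have hk : y ≤ 2 ^ k := by
    rw [← Real.rpow_natCast, ← Real.logb_le_iff_le_rpow (by norm_num) (by linarith)]
    exact Nat.le_ceil _
  have hk' : (k : ℝ) ≤ 1 + Real.log y / Real.log 2 := by
    have := Nat.ceil_lt_add_one (Real.logb_nonneg (b := 2) (by norm_num) hy)
    rw [Real.logb] at this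
    change ((⌈Real.logb 2 y⌉₊ : ℕ) : ℝ) ≤ _
    rw [Real.logb]
    linarith
  have hV : 1 ≤ ballVolume N ρ := one_le_ballVolume hball hρ.le
  calc Real.log (ballVolume N (y * ρ)) ≤ Real.log (C ^ k * ballVolume N ρ) := by
        refine Real.log_le_log ?_ ?_
        · linarith [one_le_ballVolume hball (show 0 ≤ y * ρ by positivity)]
        · exact (ballVolume_mono hball (by gcongr)).trans (ballVolume_two_pow_le hball hVD hρ k)
    _ = Real.log (ballVolume N ρ) + Real.log C * k := by
        rw [Real.log_mul (by positivity) (by positivity), Real.log_pow]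
        ring
    _ ≤ _ := by
        have := Real.log_nonneg hC
        gcongr

/-- One term suffices: the least `k` with `N x ≤ 2 ^ k * ρ`. For `k ≥ 1` minimality gives `N x / ρ >
2 ^ k / 2`; the factor `e` is needed only for `k = 0`. -/
lemma exp_neg_div_le_tsum (N : GroupNorm G) {ρ : ℝ} (hρ : 0 < ρ) (x : G) :
    ENNReal.ofReal (Real.exp (-(N x / ρ))) ≤ ENNReal.ofReal (Real.exp 1) *
      ∑' k : ℕ, Set.indicator {x | N x ≤ 2 ^ k * ρ}
        (fun _ => ENNReal.ofReal (Real.exp (-(2 ^ k / 2)))) x := by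
  classical
  have hex : ∃ k : ℕ, N x ≤ 2 ^ k * ρ := by
    obtain ⟨k, hk⟩ := pow_unbounded_of_one_lt (N x / ρ) (one_lt_two : (1 : ℝ) < 2)
    exact ⟨k, ((div_lt_iff₀ hρ).1 hk).le⟩
  set k := Nat.find hex with hkdef
  have hk : N x ≤ 2 ^ k * ρ := Nat.find_spec hex
  refine le_trans ?_ (mul_le_mul_right (ENNReal.le_tsum k) _)
  rw [Set.indicator_of_mem (show x ∈ {x | N x ≤ 2 ^ k * ρ} from hk),
    ← ENNReal.ofReal_mul (Real.exp_pos _).le, ← Real.exp_add]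
  refine ENNReal.ofReal_le_ofReal (Real.exp_le_exp.2 ?_)
  rcases Nat.eq_zero_or_pos k with h0 | h0
  · rw [h0]
    have : 0 ≤ N x / ρ := div_nonneg (apply_nonneg N x) hρ.le
    norm_num
    linarith
  · have hlt := Nat.find_min hex (m := k - 1) (by omega)
    rw [not_le] at hlt
    have h2 : (2 : ℝ) ^ k / 2 = 2 ^ (k - 1) := by
      obtain ⟨j, hj⟩ := Nat.exists_eq_succ_of_ne_zero h0.ne'
      rw [hj]
      simp [pow_succ]
    have h3 : (2 : ℝ) ^ (k - 1) ≤ N x / ρ := (le_div_iff₀ hρ).2 hlt.le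
    rw [h2]
    linarith

lemma summable_pow_mul_exp_neg_two_pow {C : ℝ} (hC : 0 < C) :
    Summable fun k : ℕ => C ^ k * Real.exp (-(2 ^ k / 2)) := by
  refine summable_of_ratio_test_tendsto_lt_one zero_lt_one ?_ ?_
  · exact Eventually.of_forall fun k => by positivity
  · have h : ∀ k : ℕ, ‖C ^ (k + 1) * Real.exp (-(2 ^ (k + 1) / 2))‖ /
        ‖C ^ k * Real.exp (-(2 ^ k / 2))‖ = C * Real.exp (-(2 ^ k / 2)) := by
      intro k
      rw [Real.norm_of_nonneg (by positivity), Real.norm_of_nonneg (by positivity)]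
      have : Real.exp (-(2 ^ (k + 1) / 2))
          = Real.exp (-(2 ^ k / 2)) * Real.exp (-(2 ^ k / 2)) := by
        rw [← Real.exp_add]
        ring_nf
      rw [this, pow_succ]
      field_simp
    simp only [h]
    have h1 : Tendsto (fun k : ℕ => (2 : ℝ) ^ k / 2) atTop atTop :=
      (tendsto_pow_atTop_atTop_of_one_lt one_lt_two).atTop_div_const two_pos
    have h2 := (Real.tendsto_exp_neg_atTop_nhds_zero.comp h1).const_mul C
    simpa using h2

/-- Partition function of the Gibbs law `exp (-N / ρ)`, used in the entropy bound. Doubling costs `C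
^ k` on the `k`-th dyadic ball, which the doubly exponential weight `exp (-2 ^ k / 2)` beats. -/
lemma exists_tsum_exp_neg_le (hball : ∀ ρ : ℝ, {g : G | N g ≤ ρ}.Finite) {C : ℝ}
    (hVD : ∀ ρ : ℝ, 0 < ρ → ballVolume N (2 * ρ) ≤ C * ballVolume N ρ) :
    ∃ Z : ℝ, 1 ≤ Z ∧ ∀ ρ : ℝ, 0 < ρ → Summable (fun x => Real.exp (-(N x / ρ))) ∧
      ∑' x, Real.exp (-(N x / ρ)) ≤ Z * ballVolume N ρ := by
  have hC := one_le_doubling_const hball hVD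
  have hsum := summable_pow_mul_exp_neg_two_pow (show 0 < C by linarith)
  set S := ∑' k : ℕ, C ^ k * Real.exp (-(2 ^ k / 2)) with hS
  have hS0 : 0 ≤ S := tsum_nonneg fun k => by positivity
  refine ⟨max 1 (Real.exp 1 * S), le_max_left _ _, fun ρ hρ => ?_⟩
  have hV : 1 ≤ ballVolume N ρ := one_le_ballVolume hball hρ.le
  have hbound : ∑' x, ENNReal.ofReal (Real.exp (-(N x / ρ)))
      ≤ ENNReal.ofReal (max 1 (Real.exp 1 * S) * ballVolume N ρ) := by
    calc ∑' x, ENNReal.ofReal (Real.exp (-(N x / ρ)))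
        ≤ ∑' x, ENNReal.ofReal (Real.exp 1) * ∑' k : ℕ, Set.indicator {x | N x ≤ 2 ^ k * ρ}
          (fun _ => ENNReal.ofReal (Real.exp (-(2 ^ k / 2)))) x :=
          ENNReal.tsum_le_tsum fun x => exp_neg_div_le_tsum N hρ x
      _ = ENNReal.ofReal (Real.exp 1) * ∑' k : ℕ,
          ENNReal.ofReal (ballVolume N (2 ^ k * ρ)) * ENNReal.ofReal (Real.exp (-(2 ^ k / 2))) := by
          rw [ENNReal.tsum_mul_left, ENNReal.tsum_comm]
          congr 2; funext k
          rw [← tsum_subtype, ENNReal.tsum_const, ballVolume, ENNReal.ofReal_natCast]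
          congr 1
          have : Finite {x : G | N x ≤ 2 ^ k * ρ} := hball _
          rw [ENat.card_eq_coe_natCard, Nat.card_coe_set_eq]
          rfl
      _ ≤ ENNReal.ofReal (Real.exp 1) * ∑' k : ℕ,
          ENNReal.ofReal (C ^ k * Real.exp (-(2 ^ k / 2))) * ENNReal.ofReal (ballVolume N ρ) := by
          refine mul_le_mul_right (ENNReal.tsum_le_tsum fun k => ?_) _
          have hVk : 1 ≤ ballVolume N (2 ^ k * ρ) := one_le_ballVolume hball (by positivity)
          rw [← ENNReal.ofReal_mul (by positivity), ← ENNReal.ofReal_mul (by positivity)]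
          refine ENNReal.ofReal_le_ofReal ?_
          have := mul_le_mul_of_nonneg_right (ballVolume_two_pow_le hball hVD hρ k)
            (Real.exp_pos (-(2 ^ k / 2))).le
          linarith
      _ = ENNReal.ofReal (Real.exp 1 * S * ballVolume N ρ) := by
          rw [ENNReal.tsum_mul_right, ← ENNReal.ofReal_tsum_of_nonneg
            (fun k => by positivity) hsum, ← mul_assoc, ← ENNReal.ofReal_mul (Real.exp_pos _).le,
            ← ENNReal.ofReal_mul (by positivity)]
      _ ≤ _ := by
          refine ENNReal.ofReal_le_ofReal ?_
          gcongr
          exact le_max_right _ _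
  have hs : Summable (fun x => Real.exp (-(N x / ρ))) := by
    have := ENNReal.summable_toReal (ne_top_of_le_ne_top ENNReal.ofReal_ne_top hbound)
    refine this.congr fun x => ENNReal.toReal_ofReal (Real.exp_pos _).le
  refine ⟨hs, ?_⟩
  rw [← ENNReal.ofReal_tsum_of_nonneg (fun x => (Real.exp_pos _).le) hs] at hbound
  exact (ENNReal.ofReal_le_ofReal_iff (by positivity)).1 hbound

end Volume

/-! ### Mean norm, second moment and entropy -/

section Moments

variable {N : GroupNorm G} {p : PMF G}

lemma hasSum_sqMoment (h : sqMoment N p ≠ ⊤) :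
    HasSum (fun x => (p x).toReal * N x ^ 2) (sqMoment N p).toReal := by
  have h1 := ENNReal.hasSum_toReal h
  rw [← ENNReal.tsum_toReal_eq (fun x => ENNReal.mul_ne_top (p.apply_ne_top _)
    ENNReal.ofReal_ne_top)] at h1
  refine h1.congr_fun fun x => ?_
  rw [ENNReal.toReal_mul, ENNReal.toReal_ofReal (sq_nonneg _)]

lemma summable_mul_norm (h : sqMoment N p ≠ ⊤) : Summable fun x => (p x).toReal * N x := by
  refine Summable.of_nonneg_of_le (fun x => mul_nonneg ENNReal.toReal_nonneg (apply_nonneg N x))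
    (fun x => ?_) ((hasSum_toReal p).summable.add (hasSum_sqMoment h).summable)
  have h1 : N x ≤ 1 + N x ^ 2 := by nlinarith [sq_nonneg (N x - 1)]
  calc _ ≤ (p x).toReal * (1 + N x ^ 2) := by gcongr
    _ = _ := by ring

lemma meanNorm_nonneg : 0 ≤ meanNorm N p :=
  tsum_nonneg fun x => mul_nonneg ENNReal.toReal_nonneg (apply_nonneg N x)

lemma meanNorm_le_of_sqMoment_le {s : ℝ} (hs : 0 < s) (h : sqMoment N p ≤ ENNReal.ofReal (s ^ 2)) :
    meanNorm N p ≤ s := by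
  have hne := ne_top_of_le_ne_top ENNReal.ofReal_ne_top h
  have h1 : (sqMoment N p).toReal ≤ s ^ 2 := by
    have := ENNReal.toReal_mono ENNReal.ofReal_ne_top h
    rwa [ENNReal.toReal_ofReal (by positivity)] at this
  have h2 := ((hasSum_sqMoment hne).mul_left (1 / (2 * s))).add
    ((hasSum_toReal p).mul_left (s / 2))
  have h3 : meanNorm N p ≤ 1 / (2 * s) * (sqMoment N p).toReal + s / 2 * 1 := by
    refine hasSum_le (fun x => ?_) (summable_mul_norm hne).hasSum h2
    have : 1 / (2 * s) * ((p x).toReal * N x ^ 2) + s / 2 * (p x).toReal - (p x).toReal * N x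
        = (p x).toReal * (N x - s) ^ 2 / (2 * s) := by
      field_simp
      ring
    have h4 : 0 ≤ (p x).toReal * (N x - s) ^ 2 / (2 * s) := by positivity
    linarith
  calc meanNorm N p ≤ _ := h3
    _ ≤ 1 / (2 * s) * s ^ 2 + s / 2 * 1 := by gcongr
    _ = s := by field_simp; ring

/-- Pointwise Gibbs inequality, that is `log v ≤ v - 1` at `v = exp (-φ) / u`. -/
lemma negMulLog_le {u φ : ℝ} (hu : 0 ≤ u) : Real.negMulLog u ≤ u * φ + Real.exp (-φ) - u := by
  rcases hu.eq_or_lt with rfl | hu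
  · simp [Real.exp_nonneg]
  have h := Real.log_le_sub_one_of_pos (show 0 < Real.exp (-φ) / u by positivity)
  rw [Real.log_div (Real.exp_pos _).ne' hu.ne', Real.log_exp] at h
  have h2 := mul_le_mul_of_nonneg_left h hu.le
  have h3 : u * (Real.exp (-φ) / u - 1) = Real.exp (-φ) - u := by field_simp
  rw [Real.negMulLog]
  nlinarith

lemma summable_negMulLog (hM : Summable fun x => (p x).toReal * N x)
    (hE : Summable fun x => Real.exp (-(N x / 1))) :
    Summable fun x => Real.negMulLog (p x).toReal := by
  refine Summable.of_nonneg_of_le (fun x => ?_) (fun x => ?_) (hM.add hE)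
  · refine Real.negMulLog_nonneg ENNReal.toReal_nonneg ?_
    exact ENNReal.toReal_le_of_le_ofReal zero_le_one (by simpa using p.coe_le_one x)
  · have := negMulLog_le (φ := N x) (ENNReal.toReal_nonneg (a := p x))
    have h0 := ENNReal.toReal_nonneg (a := p x)
    rw [div_one]
    linarith

/-- Gibbs variational principle: compare with the density `exp (-N / ρ) / Y`, i.e. take `φ = N / ρ +
log Y`. The mean norm costs at most 1, and the comparison density has mass at most 1. -/
lemma entropy_le (hM : Summable fun x => (p x).toReal * N x) {ρ Y : ℝ} (hρ : 0 < ρ)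
    (hMρ : meanNorm N p ≤ ρ) (hE : Summable fun x => Real.exp (-(N x / ρ))) (hY : 0 < Y)
    (hEY : ∑' x, Real.exp (-(N x / ρ)) ≤ Y)
    (hH : Summable fun x => Real.negMulLog (p x).toReal) :
    entropy p ≤ 1 + Real.log Y := by
  have h1 : HasSum (fun x => (p x).toReal * (N x / ρ + Real.log Y)
      + Real.exp (-(N x / ρ + Real.log Y)) - (p x).toReal)
      (meanNorm N p / ρ + Real.log Y + (∑' x, Real.exp (-(N x / ρ))) / Y - 1) := by
    have := (((hM.hasSum.div_const ρ).add ((hasSum_toReal p).mul_right (Real.log Y))).add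
      (hE.hasSum.div_const Y)).sub (hasSum_toReal p)
    rw [one_mul] at this
    refine this.congr_fun fun x => ?_
    rw [neg_add, Real.exp_add, Real.exp_neg (Real.log Y), Real.exp_log hY]
    ring
  have h2 := hasSum_le (fun x => negMulLog_le ENNReal.toReal_nonneg) hH.hasSum h1
  have h3 : meanNorm N p / ρ ≤ 1 := (div_le_one hρ).2 hMρ
  have h4 : (∑' x, Real.exp (-(N x / ρ))) / Y ≤ 1 := (div_le_one hY).2 hEY
  change entropy p ≤ _ at h2
  linarith

lemma neg_log_le_entropy {α : Type*} {p : PMF α} {c : ℝ} (hp : ∀ x, (p x).toReal ≤ c)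
    (hH : Summable fun x => Real.negMulLog (p x).toReal) : -Real.log c ≤ entropy p := by
  have h1 := (hasSum_toReal p).mul_right (-Real.log c)
  rw [one_mul] at h1
  refine hasSum_le (fun x => ?_) h1 hH.hasSum
  rcases (ENNReal.toReal_nonneg (a := p x)).eq_or_lt with h | h
  · simp [← h]
  · have := mul_le_mul_of_nonneg_left (Real.log_le_log h (hp x)) h.le
    rw [Real.negMulLog]
    linarith

end Moments

/-! ### Nash's moment argument -/

/-- Discrete form of integrating Nash's differential inequality. The quantity `g k = H k + a + κ log
(n / k)` is nonnegative, and summation by parts against the weights `s√k` leaves only its final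
value and sums of `1/√k`. -/
lemma le_of_entropy_increments {M H : ℕ → ℝ} {s κ a : ℝ} {n : ℕ} (hs : 0 < s) (hκ : 0 ≤ κ)
    (hM : ∀ k, 0 ≤ M k) (h1 : M 1 ≤ s) (h2 : M 2 ≤ 2 * s) (hH : Monotone H)
    (hstep : ∀ k α, 0 < α → M (k + 2) - M k ≤ α * (H (k + 1) - H k) + s ^ 2 / α)
    (hlow : ∀ k : ℕ, 1 ≤ k → k ≤ n → 0 ≤ H k + a + κ * (Real.log n - Real.log k))
    {j : ℕ} (hj : 1 ≤ j) (hjn : j ≤ n) : M j ≤ s * √n * (6 + 5 * κ + H n + a) := by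
  have hn : 1 ≤ n := hj.trans hjn
  have hn' : (1 : ℝ) ≤ n := by exact_mod_cast hn
  have hg : 0 ≤ H n + a := by simpa using hlow n hn le_rfl
  have hsn : 1 ≤ √(n : ℝ) := Real.one_le_sqrt.2 hn'
  -- The increments span two indices, so the telescoping quantity is the sum of two consecutive
  -- values of `M`.
  have main : ∀ i : ℕ, 1 ≤ i → i ≤ n → M (i + 1) + M i ≤ 3 * s
      + s * √i * (H i + a + κ * (Real.log n - Real.log i)) + 3 * s * (κ + 1) * √i := by
    intro i hi
    induction i, hi using Nat.le_induction with
    | base =>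
      intro _
      have := hlow 1 le_rfl hn
      have h3 : 0 ≤ s * √((1 : ℕ) : ℝ) * (H 1 + a + κ * (Real.log n - Real.log (1 : ℕ))) :=
        mul_nonneg (by positivity) this
      have h4 : 0 ≤ 3 * s * (κ + 1) * √((1 : ℕ) : ℝ) := by positivity
      norm_num at h3 h4 ⊢
      linarith
    | succ i hi ih =>
      intro hin
      have hi' : (1 : ℝ) ≤ i := by exact_mod_cast hi
      have hi0 : (0 : ℝ) < i := by linarith
      have ih' := ih (by omega)
      -- The choice `α = s√i` makes the error `s² / α = s / √i`, whose sum is of order `s√n`.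
      have hst := hstep i (s * √i) (by positivity)
      have hlow' := hlow (i + 1) (by omega) hin
      push_cast at hlow' ⊢
      set g' := H (i + 1) + a + κ * (Real.log n - Real.log (i + 1)) with hg'
      have hlog : Real.log (i + 1) - Real.log i ≤ 1 / i := by
        rw [← Real.log_div (by positivity) (by positivity)]
        have := Real.log_le_sub_one_of_pos (show 0 < ((i : ℝ) + 1) / i by positivity)
        have h5 : ((i : ℝ) + 1) / i - 1 = 1 / i := by field_simp; ring
        linarith
      have hsq : √(i : ℝ) * √(i : ℝ) = i := Real.mul_self_sqrt hi0.le
      have hsi : 0 < √(i : ℝ) := Real.sqrt_pos.2 hi0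
      have hinv : 1 / √(i : ℝ) ≤ 3 * (√((i : ℝ) + 1) - √i) := by
        have hsq' : √((i : ℝ) + 1) * √((i : ℝ) + 1) = i + 1 := Real.mul_self_sqrt (by linarith)
        have hle : √((i : ℝ) + 1) ≤ 2 * √i := by
          rw [Real.sqrt_le_left (by positivity)]
          nlinarith
        have hpos : 0 ≤ √((i : ℝ) + 1) := Real.sqrt_nonneg _
        have hmono : √(i : ℝ) ≤ √((i : ℝ) + 1) := Real.sqrt_le_sqrt (by linarith)
        rw [div_le_iff₀ hsi]
        nlinarith
      have e1 : s ^ 2 / (s * √i) = s * (1 / √i) := by field_simp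
      have e2 : s * √i * (κ * (1 / i)) = s * κ * (1 / √i) := by
        field_simp
        nlinarith
      have hmono : √(i : ℝ) ≤ √((i : ℝ) + 1) := Real.sqrt_le_sqrt (by linarith)
      have e3 : s * √i * (H (i + 1) - H i) ≤ s * √i * (g'
          - (H i + a + κ * (Real.log n - Real.log i))) + s * κ * (1 / √i) := by
        rw [← e2, ← mul_add]
        refine mul_le_mul_of_nonneg_left ?_ (by positivity)
        have := mul_le_mul_of_nonneg_left hlog hκ
        rw [hg']
        linarith
      -- Nonnegativity of `g'` is what allows the weight to grow from `√i` to `√(i + 1)`.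
      have e4 : s * √i * g' ≤ s * √((i : ℝ) + 1) * g' := by gcongr
      have e5 : s * (κ + 1) * (1 / √i) ≤ s * (κ + 1) * (3 * (√((i : ℝ) + 1) - √i)) :=
        mul_le_mul_of_nonneg_left hinv (by positivity)
      rw [e1] at hst
      have e6 : M (i + 1 + 1) - M i ≤ s * √i * (g'
          - (H i + a + κ * (Real.log n - Real.log i))) + s * κ * (1 / √i) + s * (1 / √i) :=
        hst.trans (by linarith)
      linarith
  rcases hj.eq_or_lt with rfl | hj
  · have : s * 1 * 1 ≤ s * √n * (6 + 5 * κ + H n + a) := by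
      gcongr
      linarith
    linarith
  · obtain ⟨i, rfl⟩ : ∃ i, j = i + 1 := ⟨j - 1, by omega⟩
    have hi : 1 ≤ i := by omega
    have hin : i ≤ n := by omega
    have h3 := main i hi hin
    have hi' : (1 : ℝ) ≤ i := by exact_mod_cast hi
    have hsi : √(i : ℝ) ≤ √n := Real.sqrt_le_sqrt (by exact_mod_cast hin)
    have hsi0 : 0 < √(i : ℝ) := Real.sqrt_pos.2 (by linarith)
    -- The logarithmic correction does no harm at small `i`: `√i log (n / i) ≤ 2√n`.
    have hlog : √(i : ℝ) * (Real.log n - Real.log i) ≤ 2 * √n := by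
      have h4 : Real.log n - Real.log i = 2 * Real.log (√n / √i) := by
        rw [Real.log_div (by positivity) (by positivity), Real.log_sqrt (by positivity),
          Real.log_sqrt (by positivity)]
        ring
      have h5 := Real.log_le_sub_one_of_pos (show 0 < √(n : ℝ) / √i by positivity)
      rw [h4]
      calc √(i : ℝ) * (2 * Real.log (√n / √i)) ≤ √i * (2 * (√n / √i)) := by
            gcongr
            linarith
        _ = 2 * √n := by field_simp
    have h6 : s * √i * (H i + a + κ * (Real.log n - Real.log i))
        ≤ s * √n * (H n + a) + s * κ * (2 * √n) := by
      have h7 : s * √i * (H i + a) ≤ s * √n * (H n + a) := by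
        calc s * √i * (H i + a) ≤ s * √i * (H n + a) := by
              gcongr
              exact hH hin
          _ ≤ _ := by gcongr
      have h8 := mul_le_mul_of_nonneg_left hlog (show 0 ≤ s * κ by positivity)
      linarith
    have h9 : 3 * s * (κ + 1) * √i ≤ 3 * s * (κ + 1) * √n := by gcongr
    have h10 : 3 * s ≤ 3 * s * √n := le_mul_of_one_le_right (by positivity) hsn
    have := hM i
    linarith

section Steps

variable {N : GroupNorm G} {μ : PMF G} {s : ℝ}

lemma sqMoment_convPow_ne_top (hs : sqMoment N μ ≤ ENNReal.ofReal (s ^ 2)) (k : ℕ) :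
    sqMoment N (convPow μ k) ≠ ⊤ :=
  ne_top_of_le_ne_top (ENNReal.mul_ne_top ENNReal.ofReal_ne_top
    (ne_top_of_le_ne_top ENNReal.ofReal_ne_top hs)) (sqMoment_convPow_le N μ k)

lemma meanNorm_convPow_le (hμ : ∀ g, μ g⁻¹ = μ g)
    (hE : Summable fun x => Real.exp (-(N x / 1))) (hs0 : 0 < s)
    (hs : sqMoment N μ ≤ ENNReal.ofReal (s ^ 2)) {A κ : ℝ} (hA : 0 < A) (hκ : 0 ≤ κ) {n : ℕ}
    (hbd : ∀ k : ℕ, 1 ≤ k → k ≤ n → ∀ x, (convPow μ k x).toReal ≤ A * ((n : ℝ) / k) ^ κ)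
    {j : ℕ} (hj : 1 ≤ j) (hjn : j ≤ n) :
    meanNorm N (convPow μ j)
      ≤ s * √n * (6 + 5 * κ + entropy (convPow μ n) + Real.log A) := by
  have hM : ∀ k, Summable fun x => (convPow μ k x).toReal * N x :=
    fun k => summable_mul_norm (sqMoment_convPow_ne_top hs k)
  have hH : ∀ k, Summable fun x => Real.negMulLog (convPow μ k x).toReal :=
    fun k => summable_negMulLog (hM k) hE
  have hmean : ∀ k : ℕ, 1 ≤ k → meanNorm N (convPow μ k) ≤ k * s := by
    intro k hk
    have hk' : (0 : ℝ) < k := by exact_mod_cast hk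
    refine meanNorm_le_of_sqMoment_le (by positivity) ((sqMoment_convPow_le N μ k).trans ?_)
    rw [mul_pow, ENNReal.ofReal_mul (by positivity)]
    gcongr
  refine le_of_entropy_increments (M := fun k => meanNorm N (convPow μ k))
    (H := fun k => entropy (convPow μ k)) hs0 hκ (fun k => meanNorm_nonneg) ?_ ?_ ?_ ?_ ?_ hj hjn
  · simpa using hmean 1 le_rfl
  · simpa using hmean 2 (by norm_num)
  · exact monotone_nat_of_le_succ fun k =>
      entropy_le_entropy_mulLaw (q := convPow μ k) hμ (hH k) (hH (k + 1))
  · intro k α hα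
    have h2 := hasSum_sqMoment (ne_top_of_le_ne_top ENNReal.ofReal_ne_top hs)
    have h3 : (sqMoment N μ).toReal ≤ s ^ 2 := by
      have := ENNReal.toReal_mono ENNReal.ofReal_ne_top hs
      rwa [ENNReal.toReal_ofReal (by positivity)] at this
    have h4 := meanNorm_sub_le (N := N) (q := convPow μ k) hμ (hH k) (hH (k + 1)) (hM k)
      (hM (k + 1)) (hM (k + 2)) h2 hα
    refine h4.trans ?_
    gcongr
    exact le_rfl
  · intro k hk hkn
    have hk' : (0 : ℝ) < k := by exact_mod_cast hk
    have hn' : (0 : ℝ) < n := hk'.trans_le (by exact_mod_cast hkn)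
    have := neg_log_le_entropy (hbd k hk hkn) (hH k)
    rw [Real.log_mul (by positivity) (by positivity), Real.log_rpow (by positivity),
      Real.log_div (by positivity) (by positivity)] at this
    linarith

end Steps

/-- Closes the circular estimate for `y`, the mean norm in units of `r`: with `l = 2c + 1`, the
inequality `log (y / l) ≤ y / l` absorbs `c log y` into `y / 2` plus a constant. -/
lemma exists_le_of_le_add_log {b c : ℝ} (hc : 0 ≤ c) :
    ∃ B : ℝ, 1 ≤ B ∧ ∀ y : ℝ, 1 ≤ y → y ≤ 1 + b + c * Real.log y → b + c * Real.log y ≤ B := by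
  set l := 2 * c + 1
  have hl : 0 < l := by positivity
  refine ⟨max 1 (2 * (1 + b + c * Real.log l)), le_max_left _ _, fun y hy h => ?_⟩
  have h1 : c * Real.log y ≤ y / 2 + c * Real.log l := by
    have h2 := Real.log_le_sub_one_of_pos (show 0 < y / l by positivity)
    rw [Real.log_div (by positivity) hl.ne'] at h2
    have h3 : c * (y / l) ≤ y / 2 := by
      rw [← mul_div_assoc, div_le_div_iff₀ hl two_pos]
      change c * y * 2 ≤ y * (2 * c + 1)
      nlinarith
    nlinarith
  have h4 : y ≤ 2 * (1 + b + c * Real.log l) := by linarith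
  refine le_trans ?_ (le_max_right _ _)
  linarith

/-- Nash's moment bound: an on-diagonal upper bound at all intermediate times controls the first
moment of the norm up to the final time. -/
theorem exists_meanNorm_convPow_le {N : GroupNorm G}
    (hball : ∀ ρ : ℝ, {g : G | N g ≤ ρ}.Finite) {C : ℝ}
    (hVD : ∀ ρ : ℝ, 0 < ρ → ballVolume N (2 * ρ) ≤ C * ballVolume N ρ)
    {κ : ℝ} (hκ : 0 ≤ κ) {c₀ : ℝ} (hc₀ : 0 ≤ c₀) {K : ℝ} (hK : 1 ≤ K) :
    ∃ B : ℝ, 1 ≤ B ∧ ∀ (μ : PMF G) (n : ℕ) (s A R r : ℝ), (∀ g, μ g⁻¹ = μ g) → 0 < s →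
      sqMoment N μ ≤ ENNReal.ofReal (s ^ 2) → 0 < A → 0 < R → R ≤ r → s * √n ≤ c₀ * R →
      (∀ k : ℕ, 1 ≤ k → k ≤ n → ∀ x, (convPow μ k x).toReal ≤ A * ((n : ℝ) / k) ^ κ) →
      A * ballVolume N r ≤ K * Real.exp (r / (6 * R)) →
      ∀ j : ℕ, 1 ≤ j → j ≤ n → meanNorm N (convPow μ j) ≤ B * r := by
  obtain ⟨Z, hZ, hexp⟩ := exists_tsum_exp_neg_le hball hVD
  have hC := one_le_doubling_const hball hVD
  have hlC := Real.log_nonneg hC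
  have hlZ := Real.log_nonneg hZ
  have hlK := Real.log_nonneg hK
  have hl2 : 0 < Real.log 2 := Real.log_pos one_lt_two
  obtain ⟨B, hB, hlog⟩ := exists_le_of_le_add_log
    (b := c₀ * (8 + 5 * κ + Real.log Z + Real.log C + Real.log K))
    (c := c₀ * (Real.log C / Real.log 2)) (by positivity)
  refine ⟨B, hB, ?_⟩
  intro μ n s A R r hμ hs0 hs hA hR hRr hsn hbd hAV j hj hjn
  have hr : 0 < r := hR.trans_le hRr
  -- The volume entering the entropy bound is taken at the unknown scale `y r`, hence the
  -- self-referential inequality `hyle`.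
  set y := max 1 (meanNorm N (convPow μ n) / r) with hy
  have hy1 : 1 ≤ y := le_max_left _ _
  have hly := Real.log_nonneg hy1
  have hMn : meanNorm N (convPow μ n) ≤ y * r := by
    rw [← div_le_iff₀ hr]
    exact le_max_right _ _
  have hρ : 0 < y * r := by positivity
  have hM := summable_mul_norm (sqMoment_convPow_ne_top hs n)
  have hVy := one_le_ballVolume hball hρ.le
  have hVr := one_le_ballVolume hball hr.le
  have hent := entropy_le hM hρ hMn (hexp _ hρ).1 (by positivity) (hexp _ hρ).2
    (summable_negMulLog hM (hexp 1 one_pos).1)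
  rw [Real.log_mul (by positivity) (by positivity)] at hent
  have hV := log_ballVolume_mul_le hball hVD hr hy1
  have hA' : Real.log A + Real.log (ballVolume N r) ≤ Real.log K + r / (6 * R) := by
    rw [← Real.log_mul (by positivity) (by positivity), ← Real.log_exp (r / (6 * R)),
      ← Real.log_mul (by positivity) (by positivity)]
    exact Real.log_le_log (by positivity) hAV
  have hbound : ∀ i : ℕ, 1 ≤ i → i ≤ n → meanNorm N (convPow μ i)
      ≤ (c₀ * (8 + 5 * κ + Real.log Z + Real.log C + Real.log K)
        + c₀ * (Real.log C / Real.log 2) * Real.log y) * r := by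
    intro i hi hin
    refine (meanNorm_convPow_le hμ (hexp 1 one_pos).1 hs0 hs hA hκ hbd hi hin).trans ?_
    have hnn : 0 ≤ 7 + 5 * κ + Real.log Z + Real.log C + Real.log K
        + Real.log C / Real.log 2 * Real.log y := by positivity
    calc s * √n * (6 + 5 * κ + entropy (convPow μ n) + Real.log A)
        ≤ s * √n * (7 + 5 * κ + Real.log Z + Real.log C + Real.log K
          + Real.log C / Real.log 2 * Real.log y + r / (6 * R)) := by
          refine mul_le_mul_of_nonneg_left ?_ (by positivity)
          have e : Real.log C * (1 + Real.log y / Real.log 2)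
            = Real.log C + Real.log C / Real.log 2 * Real.log y := by ring
          linarith
      _ ≤ c₀ * R * (7 + 5 * κ + Real.log Z + Real.log C + Real.log K
          + Real.log C / Real.log 2 * Real.log y + r / (6 * R)) := by gcongr
      -- The prefactor `R` cancels the denominator of `r / (6 R)`; this is why an exponential excess
      -- of volume is tolerable.
      _ = c₀ * ((7 + 5 * κ + Real.log Z + Real.log C + Real.log K
          + Real.log C / Real.log 2 * Real.log y) * R + r / 6) := by
          field_simp
      _ ≤ c₀ * ((7 + 5 * κ + Real.log Z + Real.log C + Real.log K
          + Real.log C / Real.log 2 * Real.log y) * r + r) := by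
          gcongr
          linarith
      _ = _ := by ring
  have hyle : y ≤ 1 + c₀ * (8 + 5 * κ + Real.log Z + Real.log C + Real.log K)
      + c₀ * (Real.log C / Real.log 2) * Real.log y := by
    have h1 := (div_le_iff₀ hr).2 (hbound n (hj.trans hjn) le_rfl)
    have h2 : 0 ≤ c₀ * (8 + 5 * κ + Real.log Z + Real.log C + Real.log K) := by positivity
    have h3 : 0 ≤ c₀ * (Real.log C / Real.log 2) * Real.log y := by positivity
    exact max_le (by linarith) (by linarith)
  exact (hbound j hj hjn).trans (mul_le_mul_of_nonneg_right (hlog y hy1 hyle) hr.le)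

/-! ### On-diagonal bounds at intermediate times -/

/-- Regular variation handles large `t`. On a bounded interval, continuity bounds `m` above and
`hlow`, the probability of no jump, keeps it away from zero. -/
lemma exists_halving_const {m : ℝ → ℝ} (hm_cont : ContinuousOn m (Set.Ici 0)) {a : ℝ}
    (hm : IsRegularlyVarying m a) (hlow : ∀ t : ℝ, 0 < t → Real.exp (-t) ≤ m t) :
    ∃ D : ℝ, 1 ≤ D ∧ ∀ t : ℝ, 0 < t → m (t / 2) ≤ D * m t := by
  have h1 := hm.2 (1 / 2) (by norm_num)
  have h2 := h1.eventually (eventually_le_nhds (show (1 / 2 : ℝ) ^ a < (1 / 2 : ℝ) ^ a + 1 by linarith))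
  obtain ⟨T, hT⟩ := eventually_atTop.1 h2
  set S := max T 1
  have hS : 0 < S := lt_max_of_lt_right one_pos
  obtain ⟨b, hb⟩ := (isCompact_Icc (a := (0 : ℝ)) (b := S)).bddAbove_image
    (hm_cont.mono fun x hx => hx.1)
  refine ⟨max 1 (max ((1 / 2 : ℝ) ^ a + 1) (b * Real.exp S)), le_max_left _ _, fun t ht => ?_⟩
  have hmt : 0 < m t := (Real.exp_pos _).trans_le (hlow t ht)
  rcases le_total S t with h | h
  · have h3 := hT t ((le_max_left _ _).trans h)
    rw [div_le_iff₀ hmt] at h3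
    calc m (t / 2) = m (1 / 2 * t) := by ring_nf
      _ ≤ _ := h3
      _ ≤ _ := by
        gcongr
        exact (le_max_left _ _).trans (le_max_right _ _)
  · have h3 : m (t / 2) ≤ b := hb ⟨t / 2, ⟨by positivity, by linarith⟩, rfl⟩
    have h4 : 0 < b := ((Real.exp_pos _).trans_le (hlow (t / 2) (by positivity))).trans_le h3
    calc m (t / 2) ≤ b * (Real.exp S * Real.exp (-S)) := by
          rw [← Real.exp_add]
          simpa using h3
      _ = b * Real.exp S * Real.exp (-S) := by ring
      _ ≤ b * Real.exp S * m t := by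
          gcongr
          exact (Real.exp_le_exp.2 (by linarith)).trans (hlow t ht)
      _ ≤ _ := by
        gcongr
        exact (le_max_right _ _).trans (le_max_right _ _)

/-- Halve `t` until just below `u`, using monotonicity of `p_u(e)` in `u`; each halving costs `D`,
so the exponent is `log₂ D`. -/
lemma exists_heatKernel_le_rpow {ν : PMF G} (hν : ∀ g : G, ν g⁻¹ = ν g) {m : ℝ → ℝ} {D : ℝ}
    (hD : 1 ≤ D) (hm : ∀ t : ℝ, 0 < t → m (t / 2) ≤ D * m t)
    (hdiag : ∀ t : ℝ, 0 < t → heatKernel ν t 1 ≤ m t) {u t : ℝ} (hu : 0 < u) (hut : u ≤ t) :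
    heatKernel ν u 1 ≤ D * m t * (t / u) ^ (Real.logb 2 D) := by
  have ht : 0 < t := hu.trans_le hut
  have hmt : 0 < m t := (heatKernel_pos ν ht.le).trans_le (hdiag t ht)
  obtain ⟨k, hk, hk'⟩ := exists_nat_pow_near ((one_le_div hu).2 hut) (one_lt_two (α := ℝ))
  have hpow : ∀ j : ℕ, m (t / 2 ^ j) ≤ D ^ j * m t := by
    intro j
    induction j with
    | zero => simp
    | succ j ih =>
      calc m (t / 2 ^ (j + 1)) = m (t / 2 ^ j / 2) := by rw [pow_succ, div_div]
        _ ≤ D * m (t / 2 ^ j) := hm _ (by positivity)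
        _ ≤ D * (D ^ j * m t) := by gcongr
        _ = _ := by ring
  have h1 : t / 2 ^ (k + 1) ≤ u := by
    rw [div_le_iff₀ (by positivity)]
    have := (div_lt_iff₀ hu).1 hk'
    linarith
  have h2 : D ^ k ≤ (t / u) ^ (Real.logb 2 D) := by
    have h3 : D = 2 ^ Real.logb 2 D :=
      (Real.rpow_logb two_pos (by norm_num) (by linarith)).symm
    calc D ^ k = ((2 : ℝ) ^ k) ^ Real.logb 2 D := by
          conv_lhs => rw [h3]
          rw [← Real.rpow_natCast, ← Real.rpow_mul two_pos.le, ← Real.rpow_natCast,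
            ← Real.rpow_mul two_pos.le, mul_comm]
      _ ≤ _ := Real.rpow_le_rpow (by positivity) hk (Real.logb_nonneg one_lt_two hD)
  have h0 : 0 < t / 2 ^ (k + 1) := by positivity
  calc heatKernel ν u 1 ≤ heatKernel ν (t / 2 ^ (k + 1)) 1 := by
        rw [heatKernel_eq_toReal ν hu.le, heatKernel_eq_toReal ν h0.le]
        exact ENNReal.toReal_mono (PMF.apply_ne_top _ _) (heatLaw_one_anti hν h0.le h1)
    _ ≤ D ^ (k + 1) * m t := (hdiag _ h0).trans (hpow _)
    _ = D * m t * D ^ k := by ring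
    _ ≤ _ := by gcongr

/-! ### Nash's bound for the truncated walk -/

section Main

variable {N : GroupNorm G} {ν : PMF G} {m : ℝ → ℝ} {ε : ℝ} {R r : ℝ → ℝ}

lemma Admissible.r_pos (h : Admissible N ν m ε R r) {t : ℝ} (ht : 0 < t) : 0 < r t :=
  (h.R_pos t ht).trans_le (h.R_le t ht)

lemma exists_meanNorm_heatLaw_truncLaw_le
    (hball : ∀ ρ : ℝ, {g : G | N g ≤ ρ}.Finite) {C : ℝ}
    (hVD : ∀ ρ : ℝ, 0 < ρ → ballVolume N (2 * ρ) ≤ C * ballVolume N ρ)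
    (hν : ∀ g : G, ν g⁻¹ = ν g) (hm_cont : ContinuousOn m (Set.Ici 0)) {a : ℝ}
    (hm : IsRegularlyVarying m a) (hdiag : ∀ t : ℝ, 0 < t → heatKernel ν t 1 ≤ m t)
    (hadm : Admissible N ν m ε R r) :
    ∃ B : ℝ, 1 ≤ B ∧ ∀ t : ℝ, 0 < t → ∀ n : ℕ, t ≤ n → ∀ j : ℕ, 1 ≤ j → j ≤ n →
      meanNorm N (heatLaw (truncLaw N ν (R t)) (j * (t / n))) ≤ B * r t := by
  have hlow : ∀ t : ℝ, 0 < t → Real.exp (-t) ≤ m t :=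
    fun t ht => (exp_neg_le_heatKernel ν ht.le).trans (hdiag t ht)
  obtain ⟨D, hD, hmD⟩ := exists_halving_const hm_cont hm hlow
  obtain ⟨K, hK⟩ := hadm.bounded
  obtain ⟨B, hB, hmean⟩ := exists_meanNorm_convPow_le (N := N) hball hVD
    (Real.logb_nonneg one_lt_two hD) (c₀ := Real.exp 2) (Real.exp_pos _).le
    (K := max 1 (Real.exp ε * D * K)) (le_max_left _ _)
  refine ⟨B, hB, fun t ht n htn j hj hjn => ?_⟩
  have hn : 1 ≤ n := hj.trans hjn
  have hn' : (0 : ℝ) < n := by exact_mod_cast hn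
  have hh : 0 ≤ t / n := by positivity
  have hR := hadm.R_pos t ht
  have hmt : 0 < m t := (Real.exp_pos _).trans_le (hlow t ht)
  have hδ := tailMass_nonneg N ν (R t)
  have htail := hadm.tail_lt t ht
  rw [← convPow_heatLaw _ hh]
  -- The scale `s = e² R / √n` comes from the second moment bound `(t / n) e⁴ 𝒢(R) ≤ e⁴ R² / n`, and
  -- makes `s√n = e² R` independent of `n`. The factor `exp ε` in `A` is the price of truncation.
  refine hmean _ n (Real.exp 2 * R t / √n) (Real.exp ε * D * m t) (R t) (r t)
    (heatLaw_inv (truncLaw_inv N hν _) _) (by positivity) ?_ (by positivity) hR (hadm.R_le t ht)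
    ?_ ?_ ?_ j hj hjn
  · refine (sqMoment_heatLaw_le N _ hh ((div_le_one hn').2 htn)).trans ?_
    rw [sqMoment_truncLaw N hball, ← ENNReal.ofReal_mul (by positivity)]
    refine ENNReal.ofReal_le_ofReal ?_
    have h1 := hadm.moment_lt t ht
    rw [div_lt_iff₀ (by positivity)] at h1
    have h2 : Real.exp (-1) * R t ^ 2 ≤ 1 * R t ^ 2 := by
      gcongr
      exact Real.exp_le_one_iff.2 (by norm_num)
    rw [div_pow, mul_pow, Real.sq_sqrt hn'.le, ← Real.exp_nat_mul]
    calc t / n * Real.exp 4 * truncatedSecondMoment N ν (R t)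
        = Real.exp 4 * (t * truncatedSecondMoment N ν (R t)) / n := by ring
      _ ≤ Real.exp 4 * R t ^ 2 / n := by
        gcongr
        linarith
      _ = _ := by norm_num
  · field_simp
    exact le_rfl
  · intro k hk hkn x
    have hk' : (0 : ℝ) < k := by exact_mod_cast hk
    have hkn' : (k : ℝ) ≤ n := by exact_mod_cast hkn
    have hu : 0 < k * (t / n) := by positivity
    have hut : k * (t / n) ≤ t := by
      calc k * (t / n) = k / n * t := by ring
        _ ≤ 1 * t := by
          gcongr
          exact (div_le_one hn').2 hkn'
        _ = t := one_mul t
    rw [convPow_heatLaw _ hh]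
    have h1 : (heatLaw (truncLaw N ν (R t)) (k * (t / n)) x).toReal
        ≤ Real.exp (k * (t / n) * tailMass N ν (R t)) * heatKernel ν (k * (t / n)) 1 := by
      have h2 := (heatLaw_truncLaw_le N ν (R t) hu.le x).trans
        (mul_le_mul_right (heatLaw_le_one_apply hν hu.le x) _)
      have h3 := ENNReal.toReal_mono
        (ENNReal.mul_ne_top ENNReal.ofReal_ne_top (PMF.apply_ne_top _ _)) h2
      rwa [ENNReal.toReal_mul, ENNReal.toReal_ofReal (Real.exp_pos _).le,
        ← heatKernel_eq_toReal ν hu.le] at h3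
    have h4 : k * (t / n) * tailMass N ν (R t) ≤ ε := by
      have := mul_le_mul_of_nonneg_right hut hδ
      nlinarith [mul_nonneg ht.le hδ]
    have h5 := exists_heatKernel_le_rpow hν hD hmD hdiag hu hut
    have h6 : t / (k * (t / n)) = n / k := by field_simp
    rw [h6] at h5
    calc _ ≤ _ := h1
      _ ≤ Real.exp ε * (D * m t * ((n : ℝ) / k) ^ Real.logb 2 D) := by
        gcongr
        exact (heatKernel_pos ν hu.le).le
      _ = _ := by ring
  · have h1 := hK t ht
    rw [Real.exp_neg, ← div_eq_mul_inv, div_le_iff₀ (Real.exp_pos _)] at h1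
    calc Real.exp ε * D * m t * ballVolume N (r t)
        = Real.exp ε * D * (m t * ballVolume N (r t)) := by ring
      _ ≤ Real.exp ε * D * (K * Real.exp (r t / (6 * R t))) := by gcongr
      _ = Real.exp ε * D * K * Real.exp (r t / (6 * R t)) := by ring
      _ ≤ _ := by
        gcongr
        exact le_max_right _ _

end Main

/-! ### A maximal inequality for the discrete walk -/

section Maximal

/-- The probability that a random walk started at `x` stays in `B` during its first `j` steps. -/
def stayProb (μ : PMF G) (B : Set G) : ℕ → G → ℝ≥0∞
  | 0, _ => 1
  | j + 1, x => ∑' y, μ (x⁻¹ * y) * B.indicator (stayProb μ B j) y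

lemma stayProb_le_one (μ : PMF G) (B : Set G) (j : ℕ) (x : G) : stayProb μ B j x ≤ 1 := by
  induction j generalizing x with
  | zero => exact le_rfl
  | succ j ih =>
    calc stayProb μ B (j + 1) x ≤ ∑' y, μ (x⁻¹ * y) * 1 := by
          refine ENNReal.tsum_le_tsum fun y => mul_le_mul_right ?_ _
          exact (Set.indicator_le_self _ _ y).trans (ih y)
      _ = 1 := by simp only [mul_one]; rw [tsum_mul_left_eq, μ.tsum_coe]

/-- The mass of a law outside of a ball. -/
def outerMass (N : GroupNorm G) (p : PMF G) (a : ℝ) : ℝ≥0∞ :=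
  ∑' x, p x * Set.indicator {x | a < N x} 1 x

/-- The mass of a law in a ball. -/
def ballMass (N : GroupNorm G) (p : PMF G) (a : ℝ) : ℝ≥0∞ :=
  ∑' x, p x * Set.indicator {x | N x ≤ a} 1 x

lemma ballMass_add_outerMass (N : GroupNorm G) (p : PMF G) (a : ℝ) :
    ballMass N p a + outerMass N p a = 1 := by
  rw [ballMass, outerMass, ← ENNReal.tsum_add, ← p.tsum_coe]
  congr 1; funext x
  by_cases h : N x ≤ a
  · simp [Set.indicator, h, not_lt.2 h]
  · simp [Set.indicator, h, not_le.1 h]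

lemma outerMass_le {N : GroupNorm G} {p : PMF G} (hM : Summable fun x => (p x).toReal * N x)
    {a M : ℝ} (ha : 0 < a) (h : meanNorm N p ≤ M) : outerMass N p a ≤ ENNReal.ofReal (M / a) := by
  have hnn : ∀ x, 0 ≤ (p x).toReal * N x / a := fun x =>
    div_nonneg (mul_nonneg ENNReal.toReal_nonneg (apply_nonneg N x)) ha.le
  calc outerMass N p a ≤ ∑' x, ENNReal.ofReal ((p x).toReal * N x / a) := by
        refine ENNReal.tsum_le_tsum fun x => ?_
        by_cases hx : a < N x
        · simp only [Set.indicator, Set.mem_ofPred_eq, hx, if_true, Pi.one_apply, mul_one]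
          rw [ENNReal.le_ofReal_iff_toReal_le (PMF.apply_ne_top _ _) (hnn x), mul_div_assoc]
          exact le_mul_of_one_le_right ENNReal.toReal_nonneg ((one_le_div ha).2 hx.le)
        · simp [Set.indicator, hx]
    _ = ENNReal.ofReal (meanNorm N p / a) := by
        rw [← ENNReal.ofReal_tsum_of_nonneg hnn (hM.div_const a), tsum_div_const, meanNorm]
    _ ≤ _ := by gcongr

/-- Ottaviani's inequality. -/
lemma le_outerMass_add_stayProb (N : GroupNorm G) (μ : PMF G) {a : ℝ} {θ : ℝ≥0∞} {n : ℕ}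
    (hθ : ∀ i ≤ n, θ ≤ ballMass N (convPow μ i) a) (j : ℕ) (hj : j ≤ n) (x : G) :
    θ ≤ (∑' y, convPow μ j y * Set.indicator {z | a < N z} 1 (x * y))
      + θ * stayProb μ {z | N z ≤ 2 * a} j x := by
  induction j generalizing x with
  | zero => simp [stayProb]
  | succ j ih =>
    have h1 : ∑' y, convPow μ (j + 1) y * Set.indicator {z | a < N z} (1 : G → ℝ≥0∞) (x * y)
        = ∑' y, μ (x⁻¹ * y) *
          ∑' v, convPow μ j v * Set.indicator {z | a < N z} (1 : G → ℝ≥0∞) (y * v) := by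
      rw [add_comm, convPow_add, convPow_one, tsum_mulLaw_mul', ← tsum_mul_left_eq _ x⁻¹]
      simp [mul_assoc]
    rw [h1, stayProb, ← ENNReal.tsum_mul_left, ← ENNReal.tsum_add]
    calc θ = ∑' y, μ (x⁻¹ * y) * θ := by
          rw [ENNReal.tsum_mul_right, tsum_mul_left_eq, μ.tsum_coe, one_mul]
      _ ≤ _ := by
          refine ENNReal.tsum_le_tsum fun y => ?_
          rw [mul_left_comm θ, ← mul_add]
          refine mul_le_mul_right ?_ _
          -- If the step lands outside the ball of radius `2a`, a remaining displacement of norm at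
          -- most `a`, which has probability at least `θ`, still ends outside radius `a`. Otherwise
          -- induct from `y`.
          by_cases hy : N y ≤ 2 * a
          · rw [Set.indicator_of_mem (show y ∈ {z | N z ≤ 2 * a} from hy)]
            exact ih (by omega) y
          · refine le_trans ?_ le_self_add
            refine (hθ j (by omega)).trans (ENNReal.tsum_le_tsum fun v => mul_le_mul_right ?_ _)
            by_cases hv : v ∈ {z | N z ≤ a}
            swap
            · rw [Set.indicator_of_notMem hv]
              exact zero_le
            have h2 : N y ≤ N (y * v) + N v := by
              have := map_mul_le_add N (y * v) v⁻¹
              rwa [map_inv_eq_map, mul_inv_cancel_right] at this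
            have hv' : N v ≤ a := hv
            have h3 : y * v ∈ {z | a < N z} := by
              change a < N (y * v)
              linarith [not_le.1 hy]
            rw [Set.indicator_of_mem h3, Set.indicator_of_mem hv]
            exact le_rfl

lemma one_sub_le_stayProb {N : GroupNorm G} {μ : PMF G} {a η : ℝ} {n : ℕ} (hη0 : 0 ≤ η)
    (hη : η ≤ 1 / 2) (h : ∀ i ≤ n, outerMass N (convPow μ i) a ≤ ENNReal.ofReal η) :
    ENNReal.ofReal (1 - 2 * η) ≤ stayProb μ {z | N z ≤ 2 * a} n 1 := by
  have hθ : ∀ i ≤ n, ENNReal.ofReal (1 - η) ≤ ballMass N (convPow μ i) a := by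
    intro i hi
    rw [ENNReal.ofReal_sub _ hη0, ENNReal.ofReal_one, tsub_le_iff_right,
      ← ballMass_add_outerMass N (convPow μ i) a]
    gcongr
    exact h i hi
  have h1 := le_outerMass_add_stayProb N μ hθ n le_rfl 1
  simp only [one_mul] at h1
  have h2 := h1.trans (add_le_add_left (h n le_rfl) _)
  have hne : stayProb μ {z | N z ≤ 2 * a} n 1 ≠ ⊤ :=
    ne_top_of_le_ne_top ENNReal.one_ne_top (stayProb_le_one _ _ _ _)
  have hle := stayProb_le_one μ {z | N z ≤ 2 * a} n 1
  rw [← ENNReal.ofReal_toReal hne] at h2 hle ⊢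
  set σ := (stayProb μ {z | N z ≤ 2 * a} n 1).toReal
  have hσ0 : 0 ≤ σ := ENNReal.toReal_nonneg
  rw [← ENNReal.ofReal_mul (by linarith), ← ENNReal.ofReal_add hη0
    (mul_nonneg (by linarith) hσ0), ENNReal.ofReal_le_ofReal_iff
    (add_nonneg hη0 (mul_nonneg (by linarith) hσ0))] at h2
  rw [ENNReal.ofReal_le_one] at hle
  refine ENNReal.ofReal_le_ofReal ?_
  nlinarith

end Maximal

/-! ### From transition kernels to paths -/

section Walk

variable {ν : PMF G} {Ω : Type v} [MeasurableSpace Ω] {P : Measure Ω} {X : ℝ → Ω → G}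

lemma IsContinuousTimeWalk.measurableSet_mem (hX : IsContinuousTimeWalk ν P X) {B : Set G}
    (hB : B.Finite) {t : ℝ} (ht : 0 ≤ t) : MeasurableSet {ω | X t ω ∈ B} := by
  have : {ω | X t ω ∈ B} = ⋃ g ∈ B, {ω | X t ω = g} := by
    ext ω
    simp
  rw [this]
  exact hB.measurableSet_biUnion fun g _ => hX.measurableSet_eq t ht g

lemma IsContinuousTimeWalk.measurableSet_path (hX : IsContinuousTimeWalk ν P X) {h : ℝ}
    (hh : 0 ≤ h) (k : ℕ) (x : ℕ → G) :
    MeasurableSet {ω | ∀ i ≤ k, X ((i : ℝ) * h) ω = x i} := by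
  simp only [Set.ofPred_forall]
  exact MeasurableSet.iInter fun i => MeasurableSet.iInter fun _ =>
    hX.measurableSet_eq _ (by positivity) _

lemma IsContinuousTimeWalk.measurableSet_stay (hX : IsContinuousTimeWalk ν P X) {h : ℝ}
    (hh : 0 ≤ h) {B : Set G} (hB : B.Finite) (k l : ℕ) :
    MeasurableSet {ω | ∀ i : ℕ, k < i → i ≤ l → X ((i : ℝ) * h) ω ∈ B} := by
  simp only [Set.ofPred_forall]
  exact MeasurableSet.iInter fun i => MeasurableSet.iInter fun _ => MeasurableSet.iInter fun _ =>
    hX.measurableSet_mem hB (by positivity)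

lemma IsContinuousTimeWalk.measure_path_succ (hX : IsContinuousTimeWalk ν P X) {h : ℝ}
    (hh : 0 ≤ h) (k : ℕ) (x : ℕ → G) (hx : x 0 = 1) (y : G) :
    P {ω | ∀ i ≤ k + 1, X ((i : ℝ) * h) ω = Function.update x (k + 1) y i}
      = P {ω | ∀ i ≤ k, X ((i : ℝ) * h) ω = x i} * heatLaw ν h ((x k)⁻¹ * y) := by
  have hmono : Monotone fun i : ℕ => (i : ℝ) * h := fun i j hij => by
    have : (i : ℝ) ≤ j := by exact_mod_cast hij
    dsimp only
    gcongr
  rw [hX.fdd (k + 1) (fun i => (i : ℝ) * h) (Function.update x (k + 1) y) (by simp) hmono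
    (by simpa using hx), hX.fdd k (fun i => (i : ℝ) * h) x (by simp) hmono hx]
  have hdiff : ∀ i : ℕ, ((i + 1 : ℕ) : ℝ) * h - i * h = h := fun i => by push_cast; ring
  simp only [hdiff]
  have hnn : ∀ g, 0 ≤ heatKernel ν h g := fun g => by
    rw [heatKernel_eq_toReal ν hh]
    exact ENNReal.toReal_nonneg
  rw [Finset.prod_range_succ, ENNReal.ofReal_mul (Finset.prod_nonneg fun i _ => hnn _),
    ofReal_heatKernel ν hh]
  rw [Function.update_self, Function.update_of_ne (show k ≠ k + 1 by omega)]
  congr 2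
  refine Finset.prod_congr rfl fun i hi => ?_
  have := Finset.mem_range.1 hi
  rw [Function.update_of_ne (by omega), Function.update_of_ne (by omega)]

/-- Compares path probabilities without coupling: each step of `X` charges at least `c μ`.
Prescribing the past `x` lets the induction use only the finite dimensional distributions, and
finiteness of `B` makes the sum over the next position finite. -/
lemma IsContinuousTimeWalk.mul_stayProb_le (hX : IsContinuousTimeWalk ν P X) {h : ℝ}
    (hh : 0 ≤ h) {B : Set G} (hB : B.Finite) {μ : PMF G} {c : ℝ≥0∞}
    (hc : ∀ g, c * μ g ≤ heatLaw ν h g) (j : ℕ) : ∀ (k : ℕ) (x : ℕ → G), x 0 = 1 →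
    P {ω | ∀ i ≤ k, X ((i : ℝ) * h) ω = x i} * (c ^ j * stayProb μ B j (x k))
      ≤ P ({ω | ∀ i ≤ k, X ((i : ℝ) * h) ω = x i} ∩
        {ω | ∀ i : ℕ, k < i → i ≤ k + j → X ((i : ℝ) * h) ω ∈ B}) := by
  induction j with
  | zero =>
    intro k x hx
    have : {ω | ∀ i : ℕ, k < i → i ≤ k + 0 → X ((i : ℝ) * h) ω ∈ B} = Set.univ :=
      Set.eq_univ_of_forall fun ω i h1 h2 => by omega
    rw [this, Set.inter_univ]
    simp [stayProb]
  | succ j ih =>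
    intro k x hx
    set F := hB.toFinset with hF
    set E : G → Set Ω := fun y =>
      {ω | ∀ i ≤ k + 1, X ((i : ℝ) * h) ω = Function.update x (k + 1) y i} ∩
        {ω | ∀ i : ℕ, k + 1 < i → i ≤ k + 1 + j → X ((i : ℝ) * h) ω ∈ B} with hE
    have hsub : ⋃ y ∈ F, E y ⊆ {ω | ∀ i ≤ k, X ((i : ℝ) * h) ω = x i} ∩
        {ω | ∀ i : ℕ, k < i → i ≤ k + (j + 1) → X ((i : ℝ) * h) ω ∈ B} := by
      intro ω hω
      simp only [Set.mem_iUnion] at hω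
      obtain ⟨y, hy, h1, h2⟩ := hω
      refine ⟨fun i hi => ?_, fun i hi hi' => ?_⟩
      · have := h1 i (by omega)
        rwa [Function.update_of_ne (by omega)] at this
      · rcases Nat.lt_or_ge (k + 1) i with h3 | h3
        · exact h2 i h3 (by omega)
        · obtain rfl : i = k + 1 := by omega
          have := h1 (k + 1) le_rfl
          rw [Function.update_self] at this
          rw [this]
          simpa [hF] using hy
    have hdisj : (F : Set G).PairwiseDisjoint E := by
      intro y _ z _ hyz
      refine Set.disjoint_left.2 fun ω h1 h2 => hyz ?_
      have e1 := h1.1 (k + 1) le_rfl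
      have e2 := h2.1 (k + 1) le_rfl
      rw [Function.update_self] at e1 e2
      exact e1.symm.trans e2
    refine le_trans ?_ (measure_mono hsub)
    rw [measure_biUnion_finset hdisj fun y _ =>
      (hX.measurableSet_path hh _ _).inter (hX.measurableSet_stay hh hB _ _)]
    have hsum : stayProb μ B (j + 1) (x k) = ∑ y ∈ F, μ ((x k)⁻¹ * y) * stayProb μ B j y := by
      rw [stayProb, tsum_eq_sum (s := F)]
      · refine Finset.sum_congr rfl fun y hy => ?_
        rw [Set.indicator_of_mem (by simpa [hF] using hy)]
      · intro y hy
        rw [Set.indicator_of_notMem (by simpa [hF] using hy), mul_zero]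
    rw [hsum, Finset.mul_sum, Finset.mul_sum]
    refine Finset.sum_le_sum fun y _ => ?_
    have h1 := ih (k + 1) (Function.update x (k + 1) y) (by simpa using hx)
    rw [hX.measure_path_succ hh k x hx y, Function.update_self] at h1
    refine le_trans ?_ h1
    calc _ = P {ω | ∀ i ≤ k, X ((i : ℝ) * h) ω = x i} * (c * μ ((x k)⁻¹ * y))
          * (c ^ j * stayProb μ B j y) := by ring
      _ ≤ _ := by
        gcongr
        exact hc _

lemma IsContinuousTimeWalk.pow_mul_stayProb_le (hX : IsContinuousTimeWalk ν P X) {h : ℝ}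
    (hh : 0 ≤ h) {B : Set G} (hB : B.Finite) (h1B : (1 : G) ∈ B) {μ : PMF G} {c : ℝ≥0∞}
    (hc : ∀ g, c * μ g ≤ heatLaw ν h g) (n : ℕ) :
    c ^ n * stayProb μ B n 1 ≤ P {ω | ∀ i : ℕ, i ≤ n → X ((i : ℝ) * h) ω ∈ B} := by
  have h1 := hX.mul_stayProb_le hh hB hc n 0 (fun _ => 1) rfl
  have h0 : P {ω | ∀ i ≤ 0, X (((i : ℕ) : ℝ) * h) ω = 1} = 1 := by
    have := hX.fdd 0 (fun i => (i : ℝ) * h) (fun _ => 1) (by simp)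
      (fun i j hij => by
        have : (i : ℝ) ≤ j := by exact_mod_cast hij
        dsimp only
        gcongr) rfl
    simpa using this
  rw [h0, one_mul] at h1
  refine h1.trans (measure_mono ?_)
  rintro ω ⟨h2, h3⟩ i hi
  rcases Nat.eq_zero_or_pos i with rfl | hi0
  · rw [h2 0 le_rfl]
    exact h1B
  · exact h3 i hi0 (by omega)

lemma exists_dyadic_between {t s u : ℝ} (hs : 0 ≤ s) (hst : s < t) (hsu : s < u) :
    ∃ k i : ℕ, i ≤ 2 ^ k ∧ s < i * (t / 2 ^ k) ∧ i * (t / 2 ^ k) < u := by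
  have ht : 0 < t := hs.trans_lt hst
  obtain ⟨k, hk⟩ := pow_unbounded_of_one_lt (t / (min u t - s)) (one_lt_two : (1 : ℝ) < 2)
  have hd : 0 < min u t - s := sub_pos.2 (lt_min hsu hst)
  have h2 : (0 : ℝ) < 2 ^ k := by positivity
  have hk' : t / 2 ^ k < min u t - s := by
    rw [div_lt_iff₀ hd] at hk
    rw [div_lt_iff₀ h2]
    linarith
  have hstep : 0 < t / 2 ^ k := by positivity
  set i := ⌊s / (t / 2 ^ k)⌋₊ + 1
  have h3 : s < i * (t / 2 ^ k) := by
    rw [← div_lt_iff₀ hstep]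
    have := Nat.lt_floor_add_one (s / (t / 2 ^ k))
    change _ < ((⌊s / (t / 2 ^ k)⌋₊ + 1 : ℕ) : ℝ)
    push_cast
    exact this
  have h4 : i * (t / 2 ^ k) ≤ s + t / 2 ^ k := by
    have := Nat.floor_le (show 0 ≤ s / (t / 2 ^ k) by positivity)
    rw [le_div_iff₀ hstep] at this
    change ((⌊s / (t / 2 ^ k)⌋₊ + 1 : ℕ) : ℝ) * _ ≤ _
    push_cast
    linarith
  have h5 : i * (t / 2 ^ k) < min u t := by linarith
  refine ⟨k, i, ?_, h3, h5.trans_le (min_le_left _ _)⟩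
  have h6 := h5.trans_le (min_le_right _ _)
  have h7 : (i : ℝ) * t < 2 ^ k * t := by
    rw [← mul_div_assoc, div_lt_iff₀ h2] at h6
    linarith
  have h8 : (i : ℝ) < 2 ^ k := lt_of_mul_lt_mul_right h7 ht.le
  exact_mod_cast h8.le

/-- The margin `b < a` yields a time with norm strictly above `b` even if the supremum is not
attained. Right-continuity moves it to a later dyadic time (the endpoint `t` is already dyadic), and
the exit events increase under refinement. -/
lemma measure_runningSup_le [IsProbabilityMeasure P] (hX : IsContinuousTimeWalk ν P X)
    {N : GroupNorm G} (hball : ∀ ρ : ℝ, {g : G | N g ≤ ρ}.Finite) {t a b : ℝ} (ht : 0 < t)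
    (hb0 : 0 < b) (hba : b < a) {c : ℝ≥0∞}
    (hc : ∀ᶠ k : ℕ in atTop,
      1 - c ≤ P {ω | ∀ i : ℕ, i ≤ 2 ^ k → N (X ((i : ℝ) * (t / 2 ^ k)) ω) ≤ b}) :
    P {ω | ENNReal.ofReal a ≤ runningSup N X t ω} ≤ c := by
  set A : ℕ → Set Ω :=
    fun k => {ω | ∀ i : ℕ, i ≤ 2 ^ k → N (X ((i : ℝ) * (t / 2 ^ k)) ω) ≤ b} with hA
  have hAmeas : ∀ k, MeasurableSet (A k) := by
    intro k
    simp only [hA, Set.ofPred_forall]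
    exact MeasurableSet.iInter fun i => MeasurableSet.iInter fun _ =>
      hX.measurableSet_mem (hball b) (by positivity)
  have hAanti : ∀ k, (A k)ᶜ ⊆ (A (k + 1))ᶜ := by
    intro k
    refine Set.compl_subset_compl.2 fun ω hω i hi => ?_
    have := hω (2 * i) (by rw [pow_succ]; omega)
    have e : ((2 * i : ℕ) : ℝ) * (t / 2 ^ (k + 1)) = i * (t / 2 ^ k) := by
      push_cast
      field_simp
      ring
    rwa [e] at this
  have hmono : Monotone fun k => (A k)ᶜ := monotone_nat_of_le_succ hAanti
  have hsub : ∀ᵐ ω ∂P, ω ∈ {ω | ENNReal.ofReal a ≤ runningSup N X t ω} →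
      ω ∈ ⋃ k, (A k)ᶜ := by
    filter_upwards [hX.right_continuous] with ω hω hsup
    have h1 : ENNReal.ofReal b < runningSup N X t ω :=
      lt_of_lt_of_le ((ENNReal.ofReal_lt_ofReal_iff (hb0.trans hba)).2 hba) hsup
    simp only [runningSup, lt_iSup_iff] at h1
    obtain ⟨s, hs, h2⟩ := h1
    have h3 : b < N (X s ω) := (ENNReal.ofReal_lt_ofReal_iff_of_nonneg hb0.le).1 h2
    simp only [Set.mem_iUnion, Set.mem_compl_iff]
    rcases hs.2.eq_or_lt with rfl | hst
    · refine ⟨0, fun h4 => ?_⟩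
      have := h4 1 (by norm_num)
      norm_num at this
      linarith
    · obtain ⟨u, hu, hsubset⟩ := mem_nhdsGT_iff_exists_Ioo_subset.1 (hω s hs.1)
      obtain ⟨k, i, hi, h5, h6⟩ := exists_dyadic_between hs.1 hst hu
      refine ⟨k, fun h4 => ?_⟩
      have h7 : X (i * (t / 2 ^ k)) ω = X s ω := hsubset ⟨h5, h6⟩
      have := h4 i hi
      rw [h7] at this
      linarith
  refine (measure_mono_ae hsub).trans ?_
  refine le_of_tendsto (tendsto_measure_iUnion_atTop hmono) ?_
  filter_upwards [hc] with k hk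
  simp only [Function.comp_apply]
  rw [prob_compl_eq_one_sub (hAmeas k), tsub_le_iff_right]
  rw [tsub_le_iff_left] at hk
  exact hk

end Walk

/-! ### Confinement and the lower heat kernel bound -/

section Control

variable {N : GroupNorm G} {ν : PMF G} {m : ℝ → ℝ} {ε : ℝ} {R r : ℝ → ℝ}

lemma exists_outerMass_le
    (hball : ∀ ρ : ℝ, {g : G | N g ≤ ρ}.Finite) {C : ℝ}
    (hVD : ∀ ρ : ℝ, 0 < ρ → ballVolume N (2 * ρ) ≤ C * ballVolume N ρ)
    (hν : ∀ g : G, ν g⁻¹ = ν g) (hm_cont : ContinuousOn m (Set.Ici 0)) {a : ℝ}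
    (hm : IsRegularlyVarying m a) (hdiag : ∀ t : ℝ, 0 < t → heatKernel ν t 1 ≤ m t)
    (hadm : Admissible N ν m ε R r) :
    ∃ B : ℝ, 1 ≤ B ∧ ∀ t : ℝ, 0 < t → ∀ n : ℕ, t ≤ n → ∀ j : ℕ, j ≤ n → ∀ b : ℝ, 0 < b →
      outerMass N (convPow (heatLaw (truncLaw N ν (R t)) (t / n)) j) b
        ≤ ENNReal.ofReal (B * r t / b) := by
  obtain ⟨B, hB, h⟩ :=
    exists_meanNorm_heatLaw_truncLaw_le hball hVD hν hm_cont hm hdiag hadm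
  refine ⟨B, hB, fun t ht n htn j hj b hb => ?_⟩
  have hn : (0 : ℝ) < n := ht.trans_le htn
  rcases Nat.eq_zero_or_pos j with rfl | hj0
  · refine le_trans (le_of_eq ?_) zero_le
    rw [outerMass, ENNReal.tsum_eq_zero]
    intro x
    by_cases hx : x = 1
    · simp [hx, Set.indicator, not_lt.2 hb.le]
    · simp [convPow, PMF.pure_apply, hx]
  · have hh : 0 ≤ t / n := by positivity
    have hsq : sqMoment N (heatLaw (truncLaw N ν (R t)) (t / n)) ≠ ⊤ := by
      refine ne_top_of_le_ne_top ?_ (sqMoment_heatLaw_le N _ hh ((div_le_one hn).2 htn))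
      rw [sqMoment_truncLaw N hball]
      exact ENNReal.mul_ne_top ENNReal.ofReal_ne_top ENNReal.ofReal_ne_top
    refine outerMass_le (summable_mul_norm ?_) hb ?_
    · exact ne_top_of_le_ne_top (ENNReal.mul_ne_top ENNReal.ofReal_ne_top hsq)
        (sqMoment_convPow_le N _ j)
    · rw [convPow_heatLaw _ hh]
      exact h t ht n htn j hj0 hj

lemma exp_neg_mul_heatLaw_truncLaw_le (N : GroupNorm G) (ν : PMF G) (ρ : ℝ) {h : ℝ} (hh : 0 ≤ h)
    (g : G) : ENNReal.ofReal (Real.exp (-(h * tailMass N ν ρ))) * heatLaw (truncLaw N ν ρ) h g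
      ≤ heatLaw ν h g := by
  calc _ ≤ ENNReal.ofReal (Real.exp (-(h * tailMass N ν ρ))) *
        (ENNReal.ofReal (Real.exp (h * tailMass N ν ρ)) * heatLaw ν h g) :=
        mul_le_mul_right (heatLaw_truncLaw_le N ν ρ hh g) _
    _ = heatLaw ν h g := by
        rw [← mul_assoc, ← ENNReal.ofReal_mul (Real.exp_pos _).le, ← Real.exp_add]
        simp

lemma measure_runningSup_le_of_outerMass_le
    (hball : ∀ ρ : ℝ, {g : G | N g ≤ ρ}.Finite) {B t γ : ℝ} (ht : 0 < t) (hB : 0 ≤ B)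
    (hr : 0 < r t) (hγ : 0 < γ) (hBγ : 8 * B ≤ γ)
    (hout : ∀ n : ℕ, t ≤ n → ∀ j : ℕ, j ≤ n → ∀ b : ℝ, 0 < b →
      outerMass N (convPow (heatLaw (truncLaw N ν (R t)) (t / n)) j) b
        ≤ ENNReal.ofReal (B * r t / b))
    {Ω : Type v} [MeasurableSpace Ω] {P : Measure Ω} [IsProbabilityMeasure P] {X : ℝ → Ω → G}
    (hX : IsContinuousTimeWalk ν P X) :
    P {ω | ENNReal.ofReal (γ * r t) ≤ runningSup N X t ω}
      ≤ ENNReal.ofReal (t * tailMass N ν (R t) + 8 * B / γ) := by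
  have hδ := tailMass_nonneg N ν (R t)
  have hγr : 0 < γ * r t := by positivity
  -- Ottaviani at radius `γ r / 4` has failure probability `η = 4B / γ` and confines to radius `γ r
  -- / 2 < γ r` with loss `2η`. The `n` comparison factors multiply to `exp (-t δ)`.
  refine measure_runningSup_le hX hball ht (show 0 < 2 * (γ * r t / 4) by positivity)
    (by linarith) ?_
  obtain ⟨k₀, hk₀⟩ := pow_unbounded_of_one_lt t (one_lt_two : (1 : ℝ) < 2)
  filter_upwards [eventually_ge_atTop k₀] with k hk
  have htk : t ≤ ((2 ^ k : ℕ) : ℝ) := by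
    push_cast
    exact hk₀.le.trans (pow_le_pow_right₀ one_le_two hk)
  have hh : 0 ≤ t / ((2 ^ k : ℕ) : ℝ) := by positivity
  have hη : ∀ i ≤ 2 ^ k, outerMass N
      (convPow (heatLaw (truncLaw N ν (R t)) (t / ((2 ^ k : ℕ) : ℝ))) i) (γ * r t / 4)
      ≤ ENNReal.ofReal (4 * B / γ) := by
    intro i hi
    refine (hout (2 ^ k) htk i hi (γ * r t / 4) (by positivity)).trans (le_of_eq ?_)
    congr 1
    field_simp
  have hstay := one_sub_le_stayProb (by positivity)
    (show 4 * B / γ ≤ 1 / 2 by rw [div_le_div_iff₀ hγ two_pos]; linarith) hη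
  have hpath := hX.pow_mul_stayProb_le hh (hball (2 * (γ * r t / 4)))
    (show N 1 ≤ 2 * (γ * r t / 4) by rw [map_one_eq_zero]; positivity)
    (exp_neg_mul_heatLaw_truncLaw_le N ν (R t) hh) (2 ^ k)
  have hpow : ENNReal.ofReal (Real.exp (-(t / ((2 ^ k : ℕ) : ℝ) * tailMass N ν (R t)))) ^ (2 ^ k)
      = ENNReal.ofReal (Real.exp (-(t * tailMass N ν (R t)))) := by
    rw [← ENNReal.ofReal_pow (Real.exp_pos _).le, ← Real.exp_nat_mul]
    congr 2
    push_cast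
    field_simp
  rw [hpow] at hpath
  have hP := (mul_le_mul_right hstay _).trans hpath
  push_cast at hP
  refine le_trans ?_ hP
  rw [← ENNReal.ofReal_mul (Real.exp_pos _).le, ← ENNReal.ofReal_one,
    ← ENNReal.ofReal_sub _ (by positivity)]
  refine ENNReal.ofReal_le_ofReal ?_
  set x := t * tailMass N ν (R t)
  have hx : 0 ≤ x := mul_nonneg ht.le hδ
  have e1 : 1 - x ≤ Real.exp (-x) := by
    have := Real.add_one_le_exp (-x)
    linarith
  have e2 : Real.exp (-x) ≤ 1 := Real.exp_le_one_iff.2 (by linarith)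
  have e3 : 0 ≤ 4 * B / γ := by positivity
  have e4 : 8 * B / γ = 2 * (4 * B / γ) := by ring
  rw [e4]
  nlinarith

/-- Cauchy–Schwarz on the ball, with `p_t(e) = ∑ p_{t/2}(x)²` by symmetry. -/
lemma ballMass_sq_le (hball : ∀ ρ : ℝ, {g : G | N g ≤ ρ}.Finite) (hν : ∀ g : G, ν g⁻¹ = ν g)
    {t : ℝ} (ht : 0 < t) (b : ℝ) :
    (ballMass N (heatLaw ν (t / 2)) b).toReal ^ 2 ≤ ballVolume N b * heatKernel ν t 1 := by
  set p := heatLaw ν (t / 2)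
  set F := (hball b).toFinset with hF
  have h1 : ballMass N p b = ∑ x ∈ F, p x := by
    rw [ballMass, tsum_eq_sum (s := F)]
    · refine Finset.sum_congr rfl fun x hx => ?_
      rw [Set.indicator_of_mem (by simpa [hF] using hx)]
      simp
    · intro x hx
      rw [Set.indicator_of_notMem (by simpa [hF] using hx), mul_zero]
  have h2 : ∑ x ∈ F, (p x).toReal ^ 2 ≤ heatKernel ν t 1 := by
    rw [heatKernel_eq_toReal ν ht.le, ← add_halves t, heatLaw_add ν (by positivity) (by positivity)]
    have h3 : ∑ x ∈ F, p x ^ 2 ≤ mulLaw p p 1 := by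
      rw [mulLaw_self_one (heatLaw_inv hν _)]
      exact ENNReal.sum_le_tsum F
    have h4 := ENNReal.toReal_mono (PMF.apply_ne_top _ _) h3
    rw [ENNReal.toReal_sum fun x _ => ENNReal.pow_ne_top (PMF.apply_ne_top _ _)] at h4
    simpa using h4
  have h5 : ballVolume N b = F.card := by
    rw [ballVolume, Set.ncard_eq_toFinset_card _ (hball b)]
  rw [h1, ENNReal.toReal_sum fun x _ => PMF.apply_ne_top _ _, h5]
  refine (sq_sum_le_card_mul_sum_sq).trans ?_
  gcongr

lemma le_heatKernel_of_outerMass_le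
    (hball : ∀ ρ : ℝ, {g : G | N g ≤ ρ}.Finite) (hν : ∀ g : G, ν g⁻¹ = ν g) {B t γ : ℝ}
    (ht : 0 < t) (hr : 0 < r t) (hγ : 0 < γ) (hB : 0 ≤ B) (hε : 0 < ε)
    (htail : 2 * t * tailMass N ν (R t) < ε) (hBγ : 4 * B ≤ ε * γ)
    (hout : ∀ n : ℕ, t ≤ n → ∀ j : ℕ, j ≤ n → ∀ b : ℝ, 0 < b →
      outerMass N (convPow (heatLaw (truncLaw N ν (R t)) (t / n)) j) b
        ≤ ENNReal.ofReal (B * r t / b)) :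
    (1 - ε) / ballVolume N (γ * r t) ≤ heatKernel ν t 1 := by
  have hγr : 0 < γ * r t := by positivity
  have hV := one_le_ballVolume hball hγr.le
  have hδ := tailMass_nonneg N ν (R t)
  have hp := heatKernel_pos ν ht.le
  rcases le_total 1 ε with h1 | h1
  · exact (div_nonpos_of_nonpos_of_nonneg (by linarith) (by linarith)).trans hp.le
  set l := ⌈t⌉₊ with hl
  have hl0 : 0 < l := Nat.ceil_pos.2 ht
  have hl0' : (0 : ℝ) < l := by exact_mod_cast hl0
  have htl : t ≤ l := Nat.le_ceil t
  -- With `2l` mesh intervals, exactly `l` steps reach time `t / 2`.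
  have hout' := hout (2 * l) (by push_cast; linarith) l (by omega) (γ * r t) hγr
  rw [convPow_heatLaw _ (by positivity)] at hout'
  have e1 : (l : ℝ) * (t / ((2 * l : ℕ) : ℝ)) = t / 2 := by
    push_cast
    field_simp
  have e2 : B * r t / (γ * r t) = B / γ := by field_simp
  rw [e1, e2] at hout'
  set q := heatLaw (truncLaw N ν (R t)) (t / 2)
  have hBγ' : B / γ ≤ ε / 4 := by
    rw [div_le_div_iff₀ hγ (by norm_num)]
    linarith
  have hball' : ENNReal.ofReal (1 - B / γ) ≤ ballMass N q (γ * r t) := by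
    rw [ENNReal.ofReal_sub _ (by positivity), ENNReal.ofReal_one, tsub_le_iff_right,
      ← ballMass_add_outerMass N q (γ * r t)]
    gcongr
  have hp' : ENNReal.ofReal (Real.exp (-(t / 2 * tailMass N ν (R t)))) * ballMass N q (γ * r t)
      ≤ ballMass N (heatLaw ν (t / 2)) (γ * r t) := by
    rw [ballMass, ballMass, ← ENNReal.tsum_mul_left]
    refine ENNReal.tsum_le_tsum fun x => ?_
    rw [← mul_assoc]
    gcongr
    exact exp_neg_mul_heatLaw_truncLaw_le N ν (R t) (by positivity) x
  have hlow := (mul_le_mul_right hball' _).trans hp'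
  rw [← ENNReal.ofReal_mul (Real.exp_pos _).le] at hlow
  have hne : ballMass N (heatLaw ν (t / 2)) (γ * r t) ≠ ⊤ := by
    refine ne_top_of_le_ne_top ENNReal.one_ne_top ?_
    rw [← ballMass_add_outerMass N (heatLaw ν (t / 2)) (γ * r t)]
    exact le_self_add
  have hlow' := (ENNReal.ofReal_le_iff_le_toReal hne).1 hlow
  -- Truncation and escape cost `ε / 4` each; squaring `1 - ε / 2` then leaves at least `1 - ε`.
  have hmass : 1 - ε / 2 ≤ (ballMass N (heatLaw ν (t / 2)) (γ * r t)).toReal := by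
    refine le_trans ?_ hlow'
    set x := t / 2 * tailMass N ν (R t) with hx
    have hx0 : 0 ≤ x := by positivity
    have hx1 : x ≤ ε / 4 := by rw [hx]; linarith
    have e3 : 1 - x ≤ Real.exp (-x) := by
      have := Real.add_one_le_exp (-x)
      linarith
    have e4 : 0 ≤ B / γ := by positivity
    nlinarith
  have hsq := ballMass_sq_le hball hν ht (γ * r t)
  rw [div_le_iff₀ (by linarith)]
  nlinarith

theorem Admissible.exists_control
    (hball : ∀ ρ : ℝ, {g : G | N g ≤ ρ}.Finite) {C : ℝ}
    (hVD : ∀ ρ : ℝ, 0 < ρ → ballVolume N (2 * ρ) ≤ C * ballVolume N ρ)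
    (hν : ∀ g : G, ν g⁻¹ = ν g) (hm_cont : ContinuousOn m (Set.Ici 0)) {a : ℝ}
    (hm : IsRegularlyVarying m a) (hdiag : ∀ t : ℝ, 0 < t → heatKernel ν t 1 ≤ m t)
    (hε : 0 < ε) (hadm : Admissible N ν m ε R r) :
    ∃ γ₀ : ℝ, 1 ≤ γ₀ ∧ ∀ γ : ℝ, γ₀ ≤ γ → ∀ t : ℝ, 0 < t →
      (∀ (Ω : Type v) [MeasurableSpace Ω] (P : Measure Ω) [IsProbabilityMeasure P]
        (X : ℝ → Ω → G), IsContinuousTimeWalk ν P X →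
          P {ω | ENNReal.ofReal (γ * r t) ≤ runningSup N X t ω} < ENNReal.ofReal ε) ∧
      (1 - ε) / ballVolume N (γ * r t) ≤ heatKernel ν t 1 := by
  obtain ⟨B, hB, hout⟩ := exists_outerMass_le hball hVD hν hm_cont hm hdiag hadm
  -- The first bound gives `η ≤ 1/2` in Ottaviani's inequality; the second makes the escape term at
  -- most `ε / 2`, the other half being `t δ < ε / 2`.
  refine ⟨max (8 * B) (16 * B / ε), le_max_of_le_left (by linarith), fun γ hγ t ht => ?_⟩
  have h1 : 8 * B ≤ γ := (le_max_left _ _).trans hγ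
  have h2 : 16 * B ≤ γ * ε := (div_le_iff₀ hε).1 ((le_max_right _ _).trans hγ)
  have hγ0 : 0 < γ := by linarith
  have htail := hadm.tail_lt t ht
  refine ⟨fun Ω _ P _ X hX => ?_, ?_⟩
  · refine (measure_runningSup_le_of_outerMass_le hball ht (by linarith) (hadm.r_pos ht) hγ0 h1
      (hout t ht) hX).trans_lt ((ENNReal.ofReal_lt_ofReal_iff hε).2 ?_)
    have h3 : 8 * B / γ ≤ ε / 2 := by
      rw [div_le_div_iff₀ hγ0 two_pos]
      linarith
    linarith
  · exact le_heatKernel_of_outerMass_le hball hν ht (hadm.r_pos ht) hγ0 (by linarith) hε htail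
      (by linarith) (hout t ht)

lemma comparable_heatKernel_of_le
    (hball : ∀ ρ : ℝ, {g : G | N g ≤ ρ}.Finite) {C : ℝ}
    (hVD : ∀ ρ : ℝ, 0 < ρ → ballVolume N (2 * ρ) ≤ C * ballVolume N ρ)
    (hdiag : ∀ t : ℝ, 0 < t → heatKernel ν t 1 ≤ m t) (hr : ∀ t : ℝ, 0 < t → 0 < r t)
    {c γ : ℝ} (hc : 0 < c) (hγ : 0 ≤ γ)
    (hlow : ∀ t : ℝ, 0 < t → c / ballVolume N (γ * r t) ≤ heatKernel ν t 1)
    (hcomp : Comparable (fun t => (ballVolume N (r t))⁻¹) m) :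
    Comparable (fun t => heatKernel ν t 1) (fun t => (ballVolume N (r t))⁻¹) := by
  have hC := one_le_doubling_const hball hVD
  obtain ⟨k, hk⟩ := pow_unbounded_of_one_lt γ (one_lt_two : (1 : ℝ) < 2)
  obtain ⟨c', C', hc', hC', h⟩ := hcomp
  refine ⟨c / C ^ k, c'⁻¹, by positivity, by positivity, fun t ht => ⟨?_, ?_⟩⟩
  · refine le_trans ?_ (hlow t ht)
    have hrt := hr t ht
    have hV := one_le_ballVolume hball hrt.le
    have hV0 := one_le_ballVolume hball (mul_nonneg hγ hrt.le)
    have h1 : ballVolume N (γ * r t) ≤ C ^ k * ballVolume N (r t) :=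
      (ballVolume_mono hball (by gcongr)).trans (ballVolume_two_pow_le hball hVD hrt k)
    dsimp only
    rw [div_mul_eq_mul_div, div_le_div_iff₀ (by positivity) (by linarith)]
    calc c * (ballVolume N (r t))⁻¹ * ballVolume N (γ * r t)
        ≤ c * (ballVolume N (r t))⁻¹ * (C ^ k * ballVolume N (r t)) := by gcongr
      _ = c * C ^ k := by field_simp
  · refine (hdiag t ht).trans ?_
    rw [← div_eq_inv_mul, le_div_iff₀ hc', mul_comm]
    exact (h t ht).1

end Control

end RandomWalkControl

end

/-! ### The theorem -/

open RandomWalkControl in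
theorem proposition2p3 {G : Type u} [Group G] (N : GroupNorm G)
    (hball : ∀ ρ : ℝ, {g : G | N g ≤ ρ}.Finite)
    (C_VD : ℝ) (hVD : ∀ ρ : ℝ, 0 < ρ → ballVolume N (2 * ρ) ≤ C_VD * ballVolume N ρ)
    (ν : PMF G) (hν : ∀ g : G, ν g⁻¹ = ν g)
    (m : ℝ → ℝ) (hm_nonneg : ∀ t : ℝ, 0 ≤ t → 0 ≤ m t) (hm_cont : ContinuousOn m (Set.Ici 0))
    (a : ℝ) (ha : a < 0) (hm : IsRegularlyVarying m a)
    (hdiag : ∀ t : ℝ, 0 < t → heatKernel ν t 1 ≤ m t) :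
    (∀ (ε : ℝ) (R r : ℝ → ℝ), 0 < ε → Admissible N ν m ε R r →
      (∃ γ₀ : ℝ, 1 ≤ γ₀ ∧ ∀ γ : ℝ, γ₀ ≤ γ → ∀ t : ℝ, 0 < t →
        (∀ (Ω : Type v) [MeasurableSpace Ω] (P : Measure Ω) [IsProbabilityMeasure P]
          (X : ℝ → Ω → G), IsContinuousTimeWalk ν P X →
            P {ω | ENNReal.ofReal (γ * r t) ≤ runningSup N X t ω} < ENNReal.ofReal ε) ∧
        (1 - ε) / ballVolume N (γ * r t) ≤ heatKernel ν t 1) ∧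
      (ε < 1 → Comparable (fun t => (ballVolume N (r t))⁻¹) m →
        Comparable (fun t => heatKernel ν t 1) (fun t => (ballVolume N (r t))⁻¹))) ∧
    (∀ r : ℝ → ℝ,
      (∀ ε : ℝ, 0 < ε → ∃ (A : ℝ) (R : ℝ → ℝ), 1 ≤ A ∧ Admissible N ν m ε R (fun t => A * r t)) →
      Comparable (fun t => (ballVolume N (r t))⁻¹) m →
      IsControlled.{u, v} N ν r) := by
  refine ⟨fun ε R r hε hadm => ?_, fun r hr hcomp => ?_⟩
  · have hctrl := hadm.exists_control.{u, v} hball hVD hν hm_cont hm hdiag hε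
    refine ⟨hctrl, fun hε1 hcomp => ?_⟩
    obtain ⟨γ₀, hγ₀, h⟩ := hctrl
    exact comparable_heatKernel_of_le hball hVD hdiag (fun t ht => hadm.r_pos ht)
      (sub_pos.2 hε1) (by linarith) (fun t ht => (h γ₀ le_rfl t ht).2) hcomp
  · refine ⟨?_, fun ε hε => ?_⟩
    · obtain ⟨A, R, hA, hadm⟩ := hr (1 / 2) (by norm_num)
      obtain ⟨γ₀, hγ₀, h⟩ := hadm.exists_control.{u, v} hball hVD hν hm_cont hm hdiag (by norm_num)
      -- Admissibility concerns `A r` but the volume comparison concerns `r`, so `A` is merged into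
      -- the dilation factor, which doubling absorbs.
      refine comparable_heatKernel_of_le (c := 1 - 1 / 2) (γ := γ₀ * A) hball hVD hdiag
        (fun t ht => pos_of_mul_pos_right (hadm.r_pos ht) (by linarith)) (by norm_num)
        (by positivity) (fun t ht => ?_) hcomp
      rw [mul_assoc]
      exact (h γ₀ le_rfl t ht).2
    · obtain ⟨A, R, hA, hadm⟩ := hr ε hε
      obtain ⟨γ₀, hγ₀, h⟩ := hadm.exists_control.{u, v} hball hVD hν hm_cont hm hdiag hε
      refine ⟨γ₀ * A, by positivity, fun t ht Ω _ P _ X hX => ?_⟩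
      rw [mul_assoc]
      exact ((h γ₀ le_rfl t ht).1 Ω P X hX).le
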